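/- Let $\mathcal M$ be a closed Riemannian spin manifold of dimension $4$ with spinor bundle $S$, and let $\slashed D=\slashed\partial\otimes\mathbb I_{32}$, $\slashed\partial=-i\gamma^\mu(\partial_\mu+\omega_\mu)$, be the free Dirac operator on (smooth sections in) $L^2(\mathcal M,S)\otimes\mathbb C^{32}$, where $\omega_\mu$ is the spin connection, $\gamma^\mu=e^\mu_k\gamma^k_E$ for a vierbein $e$, and $$\gamma^k_E=\begin{pmatrix}0&\sigma^k\\ \tilde\sigma^k&0\end{pmatrix},\quad \sigma^k=(\mathbb I_2,-i\sigma_j),\quad \tilde\sigma^k=(\mathbb I_2,i\sigma_j),\quad \gamma^5=\begin{pmatrix}\mathbb I_2&0\\0&-\mathbb I_2\end{pmatrix}.$$ Spinors have a chirality index $s=r,l$ (the block index above) and an index $\dot s$ with two values; $\mathbb C^{32}$ has indices $C\in\{0,1\}$ (particle/antiparticle), $I\in\{0,1,2,3\}$ (lepton $0$, colours $i,j=1,2,3$), $\alpha\in\{\dot1,\dot2,1,2\}$ (flavour; $a,b$ denote the undotted values). Matrices carry row indices below and column indices above; a bar is entrywise complex conjugation. The algebra $\mathcal A=(C^\infty(\mathcal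 M)\otimes\mathcal A_{SM})\otimes\mathbb C^2$, $\mathcal A_{SM}=\mathbb C\oplus\mathbb H\oplus M_3(\mathbb C)$, has elements $a=(c,c',q,q',m,m')$ acting by $a=\mathrm{diag}(Q,M)_C$, with $Q$, $M$ trivial in $\dot s$, $Q$ trivial in $I$, and with $$Q_r=\mathrm{diag}(c,\bar c,q')_\alpha,\quad Q_l=\mathrm{diag}(c',\bar c',q)_\alpha,\quad M_r=\mathrm{diag}(\mathsf m\otimes\mathbb I_2,\mathsf m'\otimes\mathbb I_2)_\alpha,\quad M_l=\mathrm{diag}(\mathsf m'\otimes\mathbb I_2,\mathsf m\otimes\mathbb I_2)_\alpha,$$ $\mathsf m=\mathrm{diag}(c,m)_I$, $\mathsf m'=\mathrm{diag}(c',m')_I$, quaternions being represented by $\begin{pmatrix}\alpha&\beta\\-\bar\beta&\bar\alpha\end{pmatrix}$. The twist is $\rho(c,c',q,q',m,m')=(c',c,q',q,m',m)$, and $[\slashed D,b]_\rho=\slashed D b-\rho(b)\slashed D$. The real structure is $J=\mathcal J\otimes J_F$, with $\mathcal J=i\gamma^0_E\gamma^2_E\circ cc$ and $J_F$ the exchange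 of $C=0$ and $C=1$ composed with complex conjugation $cc$. Let $\slashed A=\sum_k a_k[\slashed D,b_k]_\rho$ (a finite sum, $a_k=(c_k,c_k',q_k,q_k',m_k,m_k')$, $b_k=(d_k,d_k',p_k,p_k',n_k,n_k')$ in $\mathcal A$) be selfadjoint and unimodular, i.e. $\mathrm{Tr}\,A_\mu=0$ where $A_\mu=\sum_k\rho(a_k)\,\partial_\mu b_k$. Let $g_1,g_2,g_3$ be non-zero real numbers, and define the fields $a_\mu,B_\mu,w_\mu,W_\mu^k,V_\mu^0,V_\mu^m$ (real) and $g_\mu=g_\mu^\dagger$ by $$\sum_kc'_k\partial_\mu d_k=a_\mu-i\tfrac{g_1}2B_\mu,\qquad \sum_kq_k\partial_\mu p'_k=w_\mu\mathbb I_2-i\tfrac{g_2}2W_\mu,\qquad \sum_km'_k\partial_\mu n_k=g_\mu+iV^0_\mu\mathbb I_3+i\tfrac{g_3}2V_\mu,$$ with $W_\mu=W^k_\mu\sigma_k$ (Pauli matrices), $V_\mu=V^m_\mu\lambda_m$ (Gell-Mann matrices). Then the twisted fluctuation $\slashed D+\slashed A+J\slashed AJ^{-1}$ of the free Dirac operator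 is $D_Z=\slashed D+Z$ with $$Z=\slashed A+J\slashed AJ^{-1}=-i\gamma^\mu\begin{pmatrix}Z_\mu&0\\0&\overline{Z_\mu}\end{pmatrix}_C,\qquad Z_\mu=\gamma^5\otimes X_\mu+\mathbb I_4\otimes iY_\mu,$$ where $X_\mu$ and $Y_\mu$ are components of smooth $1$-forms on $\mathcal M$ with values in the selfadjoint matrices on the indices $(I,\alpha)$. All their flavour blocks $(\cdot)_{\alpha I}^{\beta J}$ vanish except the following ones (written as matrices in $I,J$, blocks lepton/quark): $$(X_\mu)_{\dot1I}^{\dot1J}=(X_\mu)_{\dot2I}^{\dot2J}=\begin{pmatrix}2a_\mu&\\&a_\mu\mathbb I_3+\overline{g_\mu}\end{pmatrix},\qquad (X_\mu)_{aI}^{bJ}=\delta_a^b\begin{pmatrix}w_\mu-a_\mu&\\&w_\mu\mathbb I_3-\overline{g_\mu}\end{pmatrix},$$ $$(Y_\mu)_{\dot1I}^{\dot1J}=\begin{pmatrix}0&\\&-\frac{2g_1}3B_\mu\mathbb I_3-\frac{g_3}2\overline{V_\mu}\end{pmatrix},\qquad (Y_\mu)_{\dot2I}^{\dot2J}=\begin{pmatrix}g_1B_\mu&\\&\frac{g_1}3B_\mu\mathbb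 I_3-\frac{g_3}2\overline{V_\mu}\end{pmatrix},$$ $$(Y_\mu)_{aI}^{bJ}=\begin{pmatrix}\delta_a^b\frac{g_1}2B_\mu-\frac{g_2}2(W_\mu)_a^b&\\&-\delta_a^b\left(\frac{g_1}6B_\mu\mathbb I_3+\frac{g_3}2\overline{V_\mu}\right)-\frac{g_2}2(W_\mu)_a^b\mathbb I_3\end{pmatrix}.$$ Both come from $\mathcal A_{SM}$-valued $1$-forms: if $\pi(c,q,m)=\mathrm{diag}(c,\bar c,q)_\alpha$ and $\pi'(c,q,m)=\mathrm{diag}(c,m)_I$ denote the non-twisted actions of $\mathcal A_{SM}$ on particles and on antiparticles, then $$X_\mu=\pi(s_\mu)+\eta\,\overline{\pi'(s_\mu)},\quad iY_\mu=\pi(t_\mu)+\overline{\pi'(t_\mu)},\qquad \eta=\mathrm{diag}(1,1,-1,-1)_\alpha,$$ $$s_\mu=(a_\mu,\,w_\mu,\,g_\mu),\qquad t_\mu=\left(-i\tfrac{g_1}2B_\mu,\,-i\tfrac{g_2}2W_\mu,\,i\left(\tfrac{g_1}6B_\mu\mathbb I_3+\tfrac{g_3}2V_\mu\right)\right).$$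 In particular $iY_\mu$ is exactly the gauge field of the Standard Model: on leptons it is $\mathrm{diag}\left(0,\ ig_1B_\mu,\ i\frac{g_1}2B_\mu\mathbb I_2-i\frac{g_2}2W_\mu\right)_\alpha$, and on quarks it is $\mathbb I_3\otimes\mathrm{diag}\left(-\frac{2i}3g_1B_\mu,\ \frac i3g_1B_\mu,\ -\frac i6g_1B_\mu\mathbb I_2-i\frac{g_2}2W_\mu\right)_\alpha-i\frac{g_3}2\overline{V_\mu}\otimes\mathbb I_4$. -/

import Mathlib

open scoped Manifold ContDiff Kronecker Quaternion Matrix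
open Bundle

noncomputable section

namespace TwistedSM

/-! ### Index sets

A spinor carries a chirality index `s = r, l` (`Sum.inl`, `Sum.inr`) and an index with two values
inside each chirality; the lepto-colour index is `I = 0` (`Sum.inl ()`) or `I = i` (`Sum.inr i`);
the flavour index is dotted (`Sum.inl`) or undotted (`Sum.inr`); the outermost sum of `Full`
is the particle/antiparticle index `C`. -/

/-- The model space of a four-dimensional manifold. -/
abbrev E4 : Type := EuclideanSpace ℝ (Fin 4)

abbrev SpinIx : Type := Fin 2 ⊕ Fin 2

abbrev Colour : Type := Unit ⊕ Fin 3

abbrev Flavour : Type := Fin 2 ⊕ Fin 2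

/-- The multi-index `(I, α)`. -/
abbrev Internal : Type := Colour × Flavour

/-- The multi-index `(s, I, α)` of one particle/antiparticle block (64 values). -/
abbrev Half : Type := SpinIx × Internal

/-- The complete multi-index (128 values). -/
abbrev Full : Type := Half ⊕ Half

/-! ### Pauli, Gell-Mann and Dirac matrices -/

/-- The Pauli matrices `σ₁, σ₂, σ₃`. -/
def pauli : Fin 3 → Matrix (Fin 2) (Fin 2) ℂ :=
  ![!![0, 1; 1, 0], !![0, -Complex.I; Complex.I, 0], !![1, 0; 0, -1]]

/-- The Gell-Mann matrices `λ₁, …, λ₈`. -/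
def gellMann : Fin 8 → Matrix (Fin 3) (Fin 3) ℂ :=
  ![!![0, 1, 0; 1, 0, 0; 0, 0, 0],
    !![0, -Complex.I, 0; Complex.I, 0, 0; 0, 0, 0],
    !![1, 0, 0; 0, -1, 0; 0, 0, 0],
    !![0, 0, 1; 0, 0, 0; 1, 0, 0],
    !![0, 0, -Complex.I; 0, 0, 0; Complex.I, 0, 0],
    !![0, 0, 0; 0, 0, 1; 0, 1, 0],
    !![0, 0, 0; 0, 0, -Complex.I; 0, Complex.I, 0],
    ((Real.sqrt 3 : ℂ)⁻¹) • !![1, 0, 0; 0, 1, 0; 0, 0, -2]]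

def sigma : Fin 4 → Matrix (Fin 2) (Fin 2) ℂ :=
  ![1, -Complex.I • pauli 0, -Complex.I • pauli 1, -Complex.I • pauli 2]

def sigmaTilde : Fin 4 → Matrix (Fin 2) (Fin 2) ℂ :=
  ![1, Complex.I • pauli 0, Complex.I • pauli 1, Complex.I • pauli 2]

/-- The Euclidean Dirac matrices in the chiral representation. -/
def gammaE (k : Fin 4) : Matrix SpinIx SpinIx ℂ :=
  Matrix.fromBlocks 0 (sigma k) (sigmaTilde k) 0

def gamma5 : Matrix SpinIx SpinIx ℂ := Matrix.fromBlocks 1 0 0 (-1)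

/-- Clifford multiplication by a vector of Euclidean four-space. -/
def cliffE (v : Fin 4 → ℝ) : Matrix SpinIx SpinIx ℂ := ∑ k, (v k : ℂ) • gammaE k

/-- The group `Spin(4)` in the spinor representation: the products of an even number of Clifford
multiplications by unit vectors. -/
def spin4 : Submonoid (Matrix SpinIx SpinIx ℂ) :=
  Submonoid.closure {h | ∃ v w : Fin 4 → ℝ,
    ∑ k, v k ^ 2 = 1 ∧ ∑ k, w k ^ 2 = 1 ∧ h = cliffE v * cliffE w}

/-- A matrix on the spinor index, acting trivially on all the other indices. -/
def spinLift (T : Matrix SpinIx SpinIx ℂ) : Matrix Full Full ℂ :=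
  Matrix.fromBlocks (T ⊗ₖ (1 : Matrix Internal Internal ℂ)) 0 0
    (T ⊗ₖ (1 : Matrix Internal Internal ℂ))

/-! ### The representation of the algebra -/

/-- The two-dimensional representation of the quaternions: `α + β j` acts as
`[[α, β], [-β̄, ᾱ]]`. -/
def quatMat (q : ℍ[ℝ]) : Matrix (Fin 2) (Fin 2) ℂ :=
  !![⟨q.re, q.imI⟩, ⟨q.imJ, q.imK⟩; -⟨q.imJ, -q.imK⟩, ⟨q.re, -q.imI⟩]

/-- `diag(c, c̄, q)` on the flavour index. -/
def flavourRep (c : ℂ) (q : ℍ[ℝ]) : Matrix Flavour Flavour ℂ :=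
  Matrix.fromBlocks !![c, 0; 0, star c] 0 0 (quatMat q)

/-- `diag(c, m)` on the lepto-colour index. -/
def colourRep (c : ℂ) (m : Matrix (Fin 3) (Fin 3) ℂ) : Matrix Colour Colour ℂ :=
  Matrix.fromBlocks (c • 1) 0 0 m

/-- The action of `(c, q, m)` in `ℂ ⊕ ℍ ⊕ M₃(ℂ)` on particles (non-twisted). -/
def particleRep (c : ℂ) (q : ℍ[ℝ]) : Matrix Internal Internal ℂ :=
  (1 : Matrix Colour Colour ℂ) ⊗ₖ flavourRep c q

/-- The action of `(c, q, m)` in `ℂ ⊕ ℍ ⊕ M₃(ℂ)` on antiparticles (non-twisted). -/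
def antiparticleRep (c : ℂ) (m : Matrix (Fin 3) (Fin 3) ℂ) : Matrix Internal Internal ℂ :=
  colourRep c m ⊗ₖ (1 : Matrix Flavour Flavour ℂ)

/-- The projection on the dotted flavours. -/
def dotted : Matrix Flavour Flavour ℂ := Matrix.fromBlocks 1 0 0 0

/-- The projection on the undotted flavours. -/
def undotted : Matrix Flavour Flavour ℂ := Matrix.fromBlocks 0 0 0 1

/-- The operator `diag(T_r, T_l)` on the chirality index, trivial on the other spinor index. -/
def chiral (Tr Tl : Matrix Internal Internal ℂ) : Matrix Half Half ℂ :=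
  (Matrix.fromBlocks 1 0 0 0 : Matrix SpinIx SpinIx ℂ) ⊗ₖ Tr
    + (Matrix.fromBlocks 0 0 0 1 : Matrix SpinIx SpinIx ℂ) ⊗ₖ Tl

section Manifold

variable (M : Type*) [TopologicalSpace M] [ChartedSpace E4 M]

/-- An element of `C^∞(M) ⊗ (ℂ ⊕ ℍ ⊕ M₃(ℂ))`. -/
structure SMFunction where
  c : C^∞⟮𝓡 4, M; 𝓘(ℝ, ℂ), ℂ⟯
  q : C^∞⟮𝓡 4, M; 𝓘(ℝ, ℍ[ℝ]), ℍ[ℝ]⟯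
  m : Matrix (Fin 3) (Fin 3) C^∞⟮𝓡 4, M; 𝓘(ℝ, ℂ), ℂ⟯

/-- The algebra `(C^∞(M) ⊗ A_SM) ⊗ ℂ²` of the minimal twist. The first component holds the unprimed
functions `c, q, m`, the second one the primed functions `c', q', m'`. -/
abbrev TwistedAlgebra : Type _ := SMFunction M × SMFunction M

variable {M}

/-- The value at `x` of the matrix-valued function `m`. -/
def SMFunction.mAt (f : SMFunction M) (x : M) : Matrix (Fin 3) (Fin 3) ℂ :=
  Matrix.of fun i j => f.m i j x

/-- The twist: the exchange of the two components. -/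
def rho (a : TwistedAlgebra M) : TwistedAlgebra M := a.swap

/-- The block `Q` of the representation, with `Q_r = diag(c, c̄, q')`, `Q_l = diag(c', c̄', q)`. -/
def repQ (a : TwistedAlgebra M) (x : M) : Matrix Half Half ℂ :=
  chiral (particleRep (a.1.c x) (a.2.q x)) (particleRep (a.2.c x) (a.1.q x))

/-- The block `M` of the representation, which acts by `diag(c, m)` on the lepto-colour index of
right dotted and left undotted components, by `diag(c', m')` on the other ones. -/
def repM (a : TwistedAlgebra M) (x : M) : Matrix Half Half ℂ :=
  chiral
    (colourRep (a.1.c x) (a.1.mAt x) ⊗ₖ dotted + colourRep (a.2.c x) (a.2.mAt x) ⊗ₖ undotted)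
    (colourRep (a.2.c x) (a.2.mAt x) ⊗ₖ dotted + colourRep (a.1.c x) (a.1.mAt x) ⊗ₖ undotted)

/-- The representation of the twisted algebra, as a matrix-valued function on the manifold. -/
def rep (a : TwistedAlgebra M) (x : M) : Matrix Full Full ℂ :=
  Matrix.fromBlocks (repQ a x) 0 0 (repM a x)

/-- The derivative of `f` at `x` in the direction of the tangent vector `v`. -/
def dirDeriv {F : Type*} [NormedAddCommGroup F] [NormedSpace ℝ F] (f : M → F) (x : M)
    (v : TangentSpace (𝓡 4) x) : F :=
  mfderiv (𝓡 4) 𝓘(ℝ, F) f x v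

/-- The entrywise derivative of a matrix-valued function. -/
def matDeriv {m n : Type*} (f : M → Matrix m n ℂ) (x : M) (v : TangentSpace (𝓡 4) x) :
    Matrix m n ℂ :=
  Matrix.of fun i j => dirDeriv (fun y => f y i j) x v

/-! ### Local coordinates -/

/-- The coordinate vector `∂_μ` at `x` of the chart `φ` (for `x` in the source of `φ`). -/
def coordVec (φ : OpenPartialHomeomorph M E4) (μ : Fin 4) (x : M) : TangentSpace (𝓡 4) x :=
  (mfderiv (𝓡 4) (𝓡 4) φ x).inverse (EuclideanSpace.single μ (1 : ℝ) : E4)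

/-- The component `v^μ` of a tangent vector at `x` in the chart `φ`. -/
def coordComp (φ : OpenPartialHomeomorph M E4) (μ : Fin 4) (x : M) (v : TangentSpace (𝓡 4) x) : ℝ :=
  let u : E4 := mfderiv (𝓡 4) (𝓡 4) φ x v
  u μ

/-- A smooth matrix-valued one-form: linear in the tangent vector, with smooth components in
every chart. -/
def IsSmoothOneForm {n : Type*} (X : (x : M) → TangentSpace (𝓡 4) x → Matrix n n ℂ) : Prop :=
  (∀ x u v, X x (u + v) = X x u + X x v) ∧
  (∀ x (r : ℝ) v, X x (r • v) = (r : ℂ) • X x v) ∧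
  ∀ φ ∈ IsManifold.maximalAtlas (𝓡 4) ∞ M, ∀ μ p q,
    ContMDiffOn (𝓡 4) 𝓘(ℝ, ℂ) ∞ (fun x => X x (coordVec φ μ x) p q) φ.source

/-! ### Spin structures, spinors and the Dirac operator -/

section Riemannian

variable [IsManifold (𝓡 4) ∞ M] [RiemannianBundle (fun x : M => TangentSpace (𝓡 4) x)]

variable (M) in
/-- A spin structure on a Riemannian four-manifold, presented by local data: an open cover by
patches, with a smooth orthonormal frame (vierbein) on each of them, and a smooth `Spin(4)`-valued
cocycle on the overlaps that lifts the change of frame. -/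
structure SpinStructure (ι : Type*) where
  patch : ι → Set M
  isOpen_patch : ∀ i, IsOpen (patch i)
  cover : ∀ x, ∃ i, x ∈ patch i
  /-- `frame i a x` is the vector `e_a` at `x` of the orthonormal frame of the patch `i`. -/
  frame : ι → Fin 4 → (x : M) → TangentSpace (𝓡 4) x
  smooth_frame : ∀ i a, ContMDiffOn (𝓡 4) (𝓡 4).tangent ∞
    (fun x => (⟨x, frame i a x⟩ : TangentBundle (𝓡 4) M)) (patch i)
  orthonormal_frame : ∀ i, ∀ x ∈ patch i, ∀ a b,
    inner ℝ (frame i a x) (frame i b x) = if a = b then 1 else 0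
  trans : ι → ι → M → Matrix SpinIx SpinIx ℂ
  smooth_trans : ∀ i j p q, ContMDiffOn (𝓡 4) 𝓘(ℝ, ℂ) ∞ (fun x => trans i j x p q)
    (patch i ∩ patch j)
  trans_mem : ∀ i j, ∀ x ∈ patch i ∩ patch j, trans i j x ∈ spin4
  cocycle : ∀ i j k, ∀ x ∈ patch i ∩ patch j ∩ patch k,
    trans i j x * trans j k x = trans i k x
  lift_frame : ∀ i j, ∀ x ∈ patch i ∩ patch j, ∀ v : TangentSpace (𝓡 4) x,
    cliffE (fun a => inner ℝ (frame i a x) v) * trans i j x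
      = trans i j x * cliffE (fun a => inner ℝ (frame j a x) v)

variable {ι : Type*}

/-- Fields on the manifold with values in (spinors) `⊗ ℂ³²`, given by their components in the
patches. Only the values of the `i`-th function on the `i`-th patch matter. -/
abbrev LocalSpinor (M : Type*) (ι : Type*) : Type _ := ι → M → Full → ℂ

/-- The smooth spinor fields with values in `ℂ³²`, that is the smooth sections of the bundle
associated with the spin structure. -/
structure IsSmoothSpinor (S : SpinStructure M ι) (ψ : LocalSpinor M ι) : Prop where
  smooth : ∀ i p, ContMDiffOn (𝓡 4) 𝓘(ℝ, ℂ) ∞ (fun x => ψ i x p) (S.patch i)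
  compat : ∀ i j, ∀ x ∈ S.patch i ∩ S.patch j, ψ i x = spinLift (S.trans i j x) *ᵥ ψ j x

/-- The Levi-Civita coefficient `g(e_a, ∇_{e_c} e_b)` in the orthonormal frame of the patch `i`, by
the Koszul formula. -/
def leviCivitaCoeff (S : SpinStructure M ι) (i : ι) (c a b : Fin 4) (x : M) : ℝ :=
  (1 / 2 : ℝ) *
    (inner ℝ (VectorField.mlieBracket (𝓡 4) (S.frame i c) (S.frame i b) x) (S.frame i a x)
      - inner ℝ (VectorField.mlieBracket (𝓡 4) (S.frame i c) (S.frame i a) x) (S.frame i b x)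
      - inner ℝ (VectorField.mlieBracket (𝓡 4) (S.frame i b) (S.frame i a) x) (S.frame i c x))

/-- The spin connection `ω(e_c) = ¼ Σ_{a,b} g(e_a, ∇_{e_c} e_b) γ^a γ^b`. -/
def spinConnection (S : SpinStructure M ι) (i : ι) (c : Fin 4) (x : M) :
    Matrix SpinIx SpinIx ℂ :=
  (1 / 4 : ℂ) • ∑ a, ∑ b, (leviCivitaCoeff S i c a b x : ℂ) • (gammaE a * gammaE b)

/-- The free Dirac operator `-i γ^μ (∂_μ + ω_μ) ⊗ 𝕀`, written in the orthonormal frames. -/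
def dirac (S : SpinStructure M ι) (ψ : LocalSpinor M ι) : LocalSpinor M ι := fun i x =>
  -Complex.I • ∑ c, spinLift (gammaE c) *ᵥ
    ((fun p => dirDeriv (fun y => ψ i y p) x (S.frame i c x))
      + spinLift (spinConnection S i c x) *ᵥ ψ i x)

/-- The curved Dirac matrix `γ^μ = Σ_a e_a^μ γ^a` at `x`, in the patch `i` of the spin structure
and the coordinates of the chart `φ`. -/
def gammaCurved (S : SpinStructure M ι) (i : ι) (φ : OpenPartialHomeomorph M E4) (μ : Fin 4)
    (x : M) : Matrix SpinIx SpinIx ℂ :=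
  ∑ a, (coordComp φ μ x (S.frame i a x) : ℂ) • gammaE a

/-- The action of the twisted algebra on spinor fields. -/
def act (a : TwistedAlgebra M) (ψ : LocalSpinor M ι) : LocalSpinor M ι := fun i x =>
  rep a x *ᵥ ψ i x

/-- The twisted commutator `[D, b]_ρ = D b - ρ(b) D` with the free Dirac operator `D`. -/
def twistedCommutator (S : SpinStructure M ι) (b : TwistedAlgebra M) (ψ : LocalSpinor M ι) :
    LocalSpinor M ι :=
  dirac S (act b ψ) - act (rho b) (dirac S ψ)

/-- The free one-form `Σ_k a_k [D, b_k]_ρ`, as an operator on spinor fields. -/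
def freeOneForm (S : SpinStructure M ι) {n : ℕ} (a b : Fin n → TwistedAlgebra M)
    (ψ : LocalSpinor M ι) : LocalSpinor M ι :=
  ∑ k, act (a k) (twistedCommutator S (b k) ψ)

end Riemannian

end Manifold

/-! ### The real structure -/

/-- The matrix of the charge conjugation `i γ⁰ γ² cc`. -/
def chargeConj : Matrix SpinIx SpinIx ℂ := Complex.I • (gammaE 0 * gammaE 2)

/-- The matrix of the real structure, that exchanges particles and antiparticles. -/
def realStructureMat : Matrix Full Full ℂ :=
  Matrix.fromBlocks 0 (chargeConj ⊗ₖ (1 : Matrix Internal Internal ℂ))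
    (chargeConj ⊗ₖ (1 : Matrix Internal Internal ℂ)) 0

/-- The real structure on the fibres: complex conjugation followed by its matrix. -/
def realStructureFun (v : Full → ℂ) : Full → ℂ := realStructureMat *ᵥ star v

theorem chargeConj_mul_map_star : chargeConj * chargeConj.map star = -1 := by
  ext i j
  rcases i with i | i <;> rcases j with j | j <;> fin_cases i <;> fin_cases j <;>
    simp [chargeConj, gammaE, sigma, sigmaTilde, pauli, Matrix.mul_apply, Matrix.one_apply]

theorem realStructureFun_realStructureFun (v : Full → ℂ) :
    realStructureFun (realStructureFun v) = -v := by
  have h1 : star (realStructureMat *ᵥ star v) = realStructureMat.map star *ᵥ v := by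
    ext p
    simp [Matrix.mulVec, dotProduct]
  have h2 : realStructureMat * realStructureMat.map star = -1 := by
    have h3 : (chargeConj ⊗ₖ (1 : Matrix Internal Internal ℂ)).map star
        = chargeConj.map star ⊗ₖ (1 : Matrix Internal Internal ℂ) := by
      ext p q
      by_cases h : p.2 = q.2 <;> simp [Matrix.kroneckerMap_apply, Matrix.one_apply, h]
    have h4 : (-1 : Matrix SpinIx SpinIx ℂ) ⊗ₖ (1 : Matrix Internal Internal ℂ) = -1 := by
      ext p q
      simp only [Matrix.kroneckerMap_apply, Matrix.neg_apply, Matrix.one_apply, Prod.ext_iff]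
      split_ifs <;> simp_all
    have h5 : (-1 : Matrix Full Full ℂ) = Matrix.fromBlocks (-1) 0 0 (-1) := by
      rw [← Matrix.fromBlocks_one, Matrix.fromBlocks_neg]
      simp
    have h6 : (0 : Matrix Half Half ℂ).map star = 0 := by ext; simp
    rw [h5]
    simp only [realStructureMat, Matrix.fromBlocks_map, Matrix.fromBlocks_multiply, h3, h6,
      ← Matrix.mul_kronecker_mul, chargeConj_mul_map_star, mul_one, h4]
    simp
  rw [realStructureFun, realStructureFun, h1, Matrix.mulVec_mulVec, h2, Matrix.neg_mulVec,
    Matrix.one_mulVec]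

/-- The real structure on the fibres, as a bijection; its square is `-1`. -/
def realStructure : (Full → ℂ) ≃ (Full → ℂ) where
  toFun := realStructureFun
  invFun v := -realStructureFun v
  left_inv v := by
    change -realStructureFun (realStructureFun v) = v
    rw [realStructureFun_realStructureFun, neg_neg]
  right_inv v := by
    change realStructureFun (-realStructureFun v) = v
    have h : realStructureFun (-realStructureFun v)
        = -realStructureFun (realStructureFun v) := by
      rw [realStructureFun, star_neg, Matrix.mulVec_neg]; rfl
    rw [h, realStructureFun_realStructureFun, neg_neg]

/-- The real structure `J` on spinor fields. -/
def opJ {M ι : Type*} (ψ : LocalSpinor M ι) : LocalSpinor M ι := fun i x => realStructure (ψ i x)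

/-- The inverse `J⁻¹` of the real structure on spinor fields. -/
def opJinv {M ι : Type*} (ψ : LocalSpinor M ι) : LocalSpinor M ι :=
  fun i x => realStructure.symm (ψ i x)

section Riemannian

variable {M : Type*} [TopologicalSpace M] [ChartedSpace E4 M] [IsManifold (𝓡 4) ∞ M]
  [RiemannianBundle (fun x : M => TangentSpace (𝓡 4) x)] {ι : Type*}

/-- The part `A + J A J⁻¹` of the twisted fluctuation, `A` being a free one-form. -/
def fluctuation (S : SpinStructure M ι) {n : ℕ} (a b : Fin n → TwistedAlgebra M)
    (ψ : LocalSpinor M ι) : LocalSpinor M ι :=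
  freeOneForm S a b ψ + opJ (freeOneForm S a b (opJinv ψ))

/-- The twisted fluctuation `D + A + J A J⁻¹` of the free Dirac operator `D`. -/
def fluctuatedDirac (S : SpinStructure M ι) {n : ℕ} (a b : Fin n → TwistedAlgebra M)
    (ψ : LocalSpinor M ι) : LocalSpinor M ι :=
  dirac S ψ + fluctuation S a b ψ

/-! ### The inner product of square-integrable spinors -/

/-- The matrix of the metric in the coordinates of the chart `φ`. -/
def metricMat (φ : OpenPartialHomeomorph M E4) (x : M) : Matrix (Fin 4) (Fin 4) ℝ :=
  Matrix.of fun μ ν => inner ℝ (coordVec φ μ x) (coordVec φ ν x)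

/-- The integral of a function against the Riemannian volume, computed with a smooth partition of
unity subordinate to charts. -/
def riemannianIntegral [T2Space M] [CompactSpace M] (f : M → ℂ) : ℂ :=
  let η := (SmoothPartitionOfUnity.exists_isSubordinate_chartAt_source (𝓡 4) M).choose
  ∑ᶠ p : M, ∫ y in (chartAt E4 p).target,
    (η p ((chartAt E4 p).symm y)
      * Real.sqrt (metricMat (chartAt E4 p) ((chartAt E4 p).symm y)).det)
      • f ((chartAt E4 p).symm y)

/-- The Hermitian product of two spinor fields at `x`; for genuine spinor fields it does not depend
on the patch. -/
def fibreInner (S : SpinStructure M ι) (ψ χ : LocalSpinor M ι) (x : M) : ℂ :=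
  star (ψ (S.cover x).choose x) ⬝ᵥ χ (S.cover x).choose x

/-- The inner product of `L²(M, S) ⊗ ℂ³²` on smooth spinor fields. -/
def l2Inner [T2Space M] [CompactSpace M]
    (S : SpinStructure M ι) (ψ χ : LocalSpinor M ι) : ℂ :=
  riemannianIntegral (fibreInner S ψ χ)

/-- Selfadjointness of an operator of order zero (a bounded one), on the dense subspace of smooth
spinor fields. -/
def IsSelfadjointOp [T2Space M] [CompactSpace M]
    (S : SpinStructure M ι) (T : LocalSpinor M ι → LocalSpinor M ι) : Prop :=
  ∀ ψ χ, IsSmoothSpinor S ψ → IsSmoothSpinor S χ → l2Inner S (T ψ) χ = l2Inner S ψ (T χ)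

end Riemannian

/-! ### The components of a free one-form, and the physical fields -/

section Fields

variable {M : Type*} [TopologicalSpace M] [ChartedSpace E4 M] {n : ℕ}
  (a b : Fin n → TwistedAlgebra M) (g₁ g₂ g₃ : ℝ) (x : M) (v : TangentSpace (𝓡 4) x)

/-- The component `A_μ = Σ_k ρ(a_k) ∂_μ b_k` of the free one-form, in the direction `v`. -/
def formComponent : Matrix Full Full ℂ := ∑ k, rep (rho (a k)) x * matDeriv (rep (b k)) x v

/-- Unimodularity: the trace of `A_μ` vanishes. -/
def IsUnimodular : Prop := ∀ (x : M) (v : TangentSpace (𝓡 4) x), (formComponent a b x v).trace = 0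

/-- The complex field `c^r = Σ_k c'_k ∂d_k`. -/
def cRight : ℂ := ∑ k, (a k).2.c x * dirDeriv (b k).1.c x v

/-- The quaternionic field `q^r = Σ_k q_k ∂p'_k`. -/
def qRight : ℍ[ℝ] := ∑ k, (a k).1.q x * dirDeriv (b k).2.q x v

/-- The `M₃(ℂ)`-valued field `m^r = Σ_k m'_k ∂n_k`. -/
def mRight : Matrix (Fin 3) (Fin 3) ℂ := ∑ k, (a k).2.mAt x * matDeriv (b k).1.mAt x v

def fieldA : ℝ := (cRight a b x v).re

def fieldB : ℝ := -(2 / g₁) * (cRight a b x v).im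

def fieldw : ℝ := (qRight a b x v).re

/-- The fields `W^k`: the components of `q^r` on `i σ_k` are `-(g₂ / 2) W^k`; in the representation
`quatMat` the matrices `i σ₁`, `i σ₂`, `i σ₃` are the quaternion units `k`, `j`, `i`. -/
def fieldWcomp : Fin 3 → ℝ :=
  ![-(2 / g₂) * (qRight a b x v).imK, -(2 / g₂) * (qRight a b x v).imJ,
    -(2 / g₂) * (qRight a b x v).imI]

/-- `W = W^k σ_k`. -/
def fieldW : Matrix (Fin 2) (Fin 2) ℂ := ∑ k, (fieldWcomp a b g₂ x v k : ℂ) • pauli k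

/-- `g`, the selfadjoint part of `m^r`. -/
def fieldg : Matrix (Fin 3) (Fin 3) ℂ := (1 / 2 : ℂ) • (mRight a b x v + (mRight a b x v)ᴴ)

/-- The fields `V^m`: `(g₃ / 2) V^m` is the component on `i λ_m` of the antiselfadjoint part of
`m^r`, with respect to the basis of `i 𝕀₃` and the `i λ_m`. As `Tr(λ_m λ_n) = 2 δ_{mn}` and the `λ_m`
are traceless, that component is `Im Tr(m^r λ_m) / 2`. -/
def fieldVcomp (m : Fin 8) : ℝ := (2 / g₃) * ((mRight a b x v * gellMann m).trace.im / 2)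

/-- `V = V^m λ_m`. -/
def fieldV : Matrix (Fin 3) (Fin 3) ℂ := ∑ m, (fieldVcomp a b g₃ x v m : ℂ) • gellMann m

end Fields

/-! ### Notation for components -/

/-- The matrix `T_α^β` on the lepto-colour index. -/
def flavourBlock (T : Matrix Internal Internal ℂ) (α β : Flavour) : Matrix Colour Colour ℂ :=
  Matrix.of fun I J => T (I, α) (J, β)

/-- The entrywise complex conjugate. -/
def conjMat {m n : Type*} (T : Matrix m n ℂ) : Matrix m n ℂ := T.map star

/-- `diag(1, 1, -1, -1)` on the flavour index. -/
def etaFlavour : Matrix Flavour Flavour ℂ := Matrix.fromBlocks 1 0 0 (-1)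

/-! ### The gauge fields of the Standard Model -/

/-- The gauge fields of the Standard Model acting on leptons. -/
def leptonGauge (g₁ g₂ B : ℝ) (W : Matrix (Fin 2) (Fin 2) ℂ) : Matrix Flavour Flavour ℂ :=
  Matrix.fromBlocks !![0, 0; 0, Complex.I * g₁ * B] 0 0
    ((Complex.I * (g₁ / 2) * B) • 1 - (Complex.I * (g₂ / 2)) • W)

/-- The gauge fields of the Standard Model acting on quarks (colour index, then flavour index). -/
def quarkGauge (g₁ g₂ g₃ B : ℝ) (W : Matrix (Fin 2) (Fin 2) ℂ) (V : Matrix (Fin 3) (Fin 3) ℂ) :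
    Matrix (Fin 3 × Flavour) (Fin 3 × Flavour) ℂ :=
  (1 : Matrix (Fin 3) (Fin 3) ℂ) ⊗ₖ
      Matrix.fromBlocks !![-Complex.I * (2 * g₁ / 3) * B, 0; 0, Complex.I * (g₁ / 3) * B] 0 0
        (-(Complex.I * (g₁ / 6) * B) • 1 - (Complex.I * (g₂ / 2)) • W)
    - ((Complex.I * (g₃ / 2)) • V) ⊗ₖ (1 : Matrix Flavour Flavour ℂ)

end TwistedSM

end

open TwistedSM

/-!
The twisted commutators `[D, b]_ρ` are computed on the fibres. A Dirac matrix `γ^c` exchanges the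
two chiralities, hence the two copies of `ℂ ⊕ ℍ ⊕ M₃(ℂ)` in the twisted algebra:
`γ^c b = ρ(b) γ^c`. The spin connection is even and commutes with the algebra. So the derivatives of
the spinor cancel, and the free one-form acts on spinors by the matrix `-i Σ_c γ^c A(e_c)`
(`freeOneForm_apply`), where `A = Σ_k ρ(a_k) db_k` again lies in the representation of the twisted
algebra: it is given by two one-forms with values in `ℂ ⊕ ℍ ⊕ M₃(ℂ)` (`formComponent_eq`), called
right- and left-handed after the chirality of the particles on which their complex components act;
their quaternionic components act on the opposite chirality.

Selfadjointness is an identity between integrals. Testing it on constant vectors multiplied by a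
bump function, and using that the integral of a nonnegative continuous function with a positive
value does not vanish (`riemannianIntegral_ne_zero`), makes it pointwise: the matrix
`-i Σ_c γ^c A(e_c)` is Hermitian (`isHermitian_oneFormMat`). The Dirac matrices are linearly
independent over the internal matrices and twist the representation, so this says that the
left-handed fields are minus the adjoints of the right-handed ones
(`formFibre_rho_eq_neg_fibreStar`). The particle blocks having a real trace, unimodularity is then a
relation between the imaginary parts of the complex field and of the trace of the `M₃(ℂ)`-field
(`im_trace_of_trace_fibreRep`); it determines the field `V⁰`, and gives the hypercharges of the
quarks.

The real structure commutes with `-i γ^c` and exchanges particles and antiparticles up to complex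
conjugation, so `A + J A J⁻¹` is `-i Σ_c γ^c diag(Z, Z̄)`, where in each chirality `Z` is the
particle block of `A` plus the complex conjugate of its antiparticle block (`fluctuation_apply`,
`fluctLin_eq_fromBlocks`). The difference and the sum of the two chiralities of `Z` define `X` and
`Y`. Splitting the right-handed field into its selfadjoint part and its antiselfadjoint part, the
left-handed field changes the sign of the first one only, so `X` is made of the selfadjoint part and
`Y` of the antiselfadjoint one (`axialLin_add_neg`, `vectorLin_add_neg`, `formPair_eq`). The
completeness of the Pauli and Gell-Mann matrices (`exists_qRight_eq`, `mRight_eq`) expresses these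
parts by the physical fields, and the components are read off.
-/

namespace TwistedSM

/-! ### Chirality and the spinor matrices -/

/-- The operator `diag(Q_r, Q_l)` on particles and `diag(M_r, M_l)` on antiparticles. -/
def blockMat (Qr Ql Mr Ml : Matrix Internal Internal ℂ) : Matrix Full Full ℂ :=
  Matrix.fromBlocks (chiral Qr Ql) 0 0 (chiral Mr Ml)

/-- A spinor matrix that exchanges the chiralities. -/
def IsOddSpin (T : Matrix SpinIx SpinIx ℂ) : Prop := ∃ s t, T = Matrix.fromBlocks 0 s t 0

/-- A spinor matrix that preserves the chiralities. -/
def IsEvenSpin (T : Matrix SpinIx SpinIx ℂ) : Prop := ∃ s t, T = Matrix.fromBlocks s 0 0 t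

theorem chiral_add (A B A' B' : Matrix Internal Internal ℂ) :
    chiral (A + A') (B + B') = chiral A B + chiral A' B' := by
  simp only [chiral, Matrix.kronecker_add]
  abel

theorem chiral_smul (r : ℂ) (A B : Matrix Internal Internal ℂ) :
    chiral (r • A) (r • B) = r • chiral A B := by
  simp only [chiral, Matrix.kronecker_smul, smul_add]

theorem chiral_mul (A B A' B' : Matrix Internal Internal ℂ) :
    chiral A B * chiral A' B' = chiral (A * A') (B * B') := by
  simp [chiral, add_mul, mul_add, ← Matrix.mul_kronecker_mul, Matrix.fromBlocks_multiply]

theorem conjMat_kronecker {l m n p : Type*} (A : Matrix l m ℂ) (B : Matrix n p ℂ) :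
    conjMat (A ⊗ₖ B) = conjMat A ⊗ₖ conjMat B := by
  ext i j
  simp [conjMat, Matrix.kroneckerMap_apply]

theorem conjMat_add {m n : Type*} (A B : Matrix m n ℂ) :
    conjMat (A + B) = conjMat A + conjMat B := by
  ext i j
  simp [conjMat]

theorem conjMat_zero {m n : Type*} : conjMat (0 : Matrix m n ℂ) = 0 := by
  ext i j
  simp [conjMat]

theorem conjMat_one {m : Type*} [DecidableEq m] : conjMat (1 : Matrix m m ℂ) = 1 := by
  ext i j
  simp only [conjMat, Matrix.map_apply, Matrix.one_apply]
  split_ifs <;> simp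

theorem conjMat_fromBlocks {l m n o : Type*} (A : Matrix n l ℂ) (B : Matrix n m ℂ)
    (C : Matrix o l ℂ) (D : Matrix o m ℂ) :
    conjMat (Matrix.fromBlocks A B C D)
      = Matrix.fromBlocks (conjMat A) (conjMat B) (conjMat C) (conjMat D) := by
  simp [conjMat, Matrix.fromBlocks_map]

theorem conjMat_chiral (A B : Matrix Internal Internal ℂ) :
    conjMat (chiral A B) = chiral (conjMat A) (conjMat B) := by
  simp [chiral, conjMat_add, conjMat_kronecker, conjMat_fromBlocks, conjMat_zero, conjMat_one]

theorem chiral_conjTranspose (A B : Matrix Internal Internal ℂ) :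
    (chiral A B)ᴴ = chiral Aᴴ Bᴴ := by
  simp [chiral, Matrix.conjTranspose_kronecker, Matrix.fromBlocks_conjTranspose]

theorem trace_chiral (A B : Matrix Internal Internal ℂ) :
    (chiral A B).trace = 2 * A.trace + 2 * B.trace := by
  simp only [chiral, Matrix.trace_add, Matrix.trace_kronecker]
  simp [Matrix.trace, Fintype.sum_sum_type]

theorem IsOddSpin.mul_chiral {T : Matrix SpinIx SpinIx ℂ} (hT : IsOddSpin T)
    (A B : Matrix Internal Internal ℂ) :
    T ⊗ₖ (1 : Matrix Internal Internal ℂ) * chiral A B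
      = chiral B A * T ⊗ₖ (1 : Matrix Internal Internal ℂ) := by
  obtain ⟨s, t, rfl⟩ := hT
  simp only [chiral, mul_add, add_mul, ← Matrix.mul_kronecker_mul, Matrix.fromBlocks_multiply]
  simp [add_comm]

theorem IsEvenSpin.mul_chiral {T : Matrix SpinIx SpinIx ℂ} (hT : IsEvenSpin T)
    (A B : Matrix Internal Internal ℂ) :
    T ⊗ₖ (1 : Matrix Internal Internal ℂ) * chiral A B
      = chiral A B * T ⊗ₖ (1 : Matrix Internal Internal ℂ) := by
  obtain ⟨s, t, rfl⟩ := hT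
  simp only [chiral, mul_add, add_mul, ← Matrix.mul_kronecker_mul, Matrix.fromBlocks_multiply]
  simp

theorem IsOddSpin.spinLift_mul_blockMat {T : Matrix SpinIx SpinIx ℂ} (hT : IsOddSpin T)
    (Qr Ql Mr Ml : Matrix Internal Internal ℂ) :
    spinLift T * blockMat Qr Ql Mr Ml = blockMat Ql Qr Ml Mr * spinLift T := by
  simp [spinLift, blockMat, Matrix.fromBlocks_multiply, hT.mul_chiral]

theorem IsEvenSpin.spinLift_mul_blockMat {T : Matrix SpinIx SpinIx ℂ} (hT : IsEvenSpin T)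
    (Qr Ql Mr Ml : Matrix Internal Internal ℂ) :
    spinLift T * blockMat Qr Ql Mr Ml = blockMat Qr Ql Mr Ml * spinLift T := by
  simp [spinLift, blockMat, Matrix.fromBlocks_multiply, hT.mul_chiral]

theorem blockMat_add (A B C D A' B' C' D' : Matrix Internal Internal ℂ) :
    blockMat (A + A') (B + B') (C + C') (D + D') = blockMat A B C D + blockMat A' B' C' D' := by
  simp [blockMat, chiral_add, Matrix.fromBlocks_add]

theorem blockMat_smul (r : ℂ) (A B C D : Matrix Internal Internal ℂ) :
    blockMat (r • A) (r • B) (r • C) (r • D) = r • blockMat A B C D := by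
  simp [blockMat, chiral_smul, Matrix.fromBlocks_smul]

theorem blockMat_mul (A B C D A' B' C' D' : Matrix Internal Internal ℂ) :
    blockMat A B C D * blockMat A' B' C' D' = blockMat (A * A') (B * B') (C * C') (D * D') := by
  simp [blockMat, chiral_mul, Matrix.fromBlocks_multiply]

theorem blockMat_conjTranspose (A B C D : Matrix Internal Internal ℂ) :
    (blockMat A B C D)ᴴ = blockMat Aᴴ Bᴴ Cᴴ Dᴴ := by
  simp [blockMat, chiral_conjTranspose, Matrix.fromBlocks_conjTranspose]

theorem conjMat_blockMat (A B C D : Matrix Internal Internal ℂ) :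
    conjMat (blockMat A B C D)
      = blockMat (conjMat A) (conjMat B) (conjMat C) (conjMat D) := by
  simp [blockMat, conjMat_chiral, conjMat_fromBlocks, conjMat_zero]

theorem trace_blockMat (A B C D : Matrix Internal Internal ℂ) :
    (blockMat A B C D).trace = 2 * (A.trace + B.trace + C.trace + D.trace) := by
  have h : (blockMat A B C D).trace = (chiral A B).trace + (chiral C D).trace := by
    simp [blockMat, Matrix.trace, Fintype.sum_sum_type]
  rw [h, trace_chiral, trace_chiral]
  ring

theorem spinLift_add (S T : Matrix SpinIx SpinIx ℂ) :
    spinLift (S + T) = spinLift S + spinLift T := by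
  simp [spinLift, Matrix.add_kronecker, Matrix.fromBlocks_add]

theorem spinLift_smul (r : ℂ) (T : Matrix SpinIx SpinIx ℂ) :
    spinLift (r • T) = r • spinLift T := by
  simp [spinLift, Matrix.smul_kronecker, Matrix.fromBlocks_smul]

theorem spinLift_mul (S T : Matrix SpinIx SpinIx ℂ) :
    spinLift (S * T) = spinLift S * spinLift T := by
  simp [spinLift, Matrix.fromBlocks_multiply, ← Matrix.mul_kronecker_mul]

theorem spinLift_one : spinLift 1 = 1 := by
  simp [spinLift]

theorem spinLift_zero : spinLift 0 = 0 := by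
  simp [spinLift]

theorem spinLift_conjTranspose (T : Matrix SpinIx SpinIx ℂ) :
    (spinLift T)ᴴ = spinLift Tᴴ := by
  simp [spinLift, Matrix.fromBlocks_conjTranspose, Matrix.conjTranspose_kronecker]

theorem conjMat_spinLift (T : Matrix SpinIx SpinIx ℂ) :
    conjMat (spinLift T) = spinLift (conjMat T) := by
  simp [spinLift, conjMat_fromBlocks, conjMat_kronecker, conjMat_zero, conjMat_one]

theorem spinLift_sum {κ : Type*} (s : Finset κ) (T : κ → Matrix SpinIx SpinIx ℂ) :
    spinLift (∑ k ∈ s, T k) = ∑ k ∈ s, spinLift (T k) := by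
  classical
  induction s using Finset.induction_on with
  | empty => simp [spinLift_zero]
  | insert k s hk ih => simp [Finset.sum_insert hk, spinLift_add, ih]

/-! ### The Dirac matrices and the spin group -/

theorem isOddSpin_gammaE (k : Fin 4) : IsOddSpin (gammaE k) := ⟨_, _, rfl⟩

theorem IsEvenSpin.mul {S T : Matrix SpinIx SpinIx ℂ} (hS : IsEvenSpin S) (hT : IsEvenSpin T) :
    IsEvenSpin (S * T) := by
  obtain ⟨s, t, rfl⟩ := hS
  obtain ⟨s', t', rfl⟩ := hT
  exact ⟨_, _, by simp [Matrix.fromBlocks_multiply]; exact ⟨rfl, rfl⟩⟩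

theorem IsOddSpin.mul {S T : Matrix SpinIx SpinIx ℂ} (hS : IsOddSpin S) (hT : IsOddSpin T) :
    IsEvenSpin (S * T) := by
  obtain ⟨s, t, rfl⟩ := hS
  obtain ⟨s', t', rfl⟩ := hT
  exact ⟨_, _, by simp [Matrix.fromBlocks_multiply]; exact ⟨rfl, rfl⟩⟩

theorem IsEvenSpin.add {S T : Matrix SpinIx SpinIx ℂ} (hS : IsEvenSpin S) (hT : IsEvenSpin T) :
    IsEvenSpin (S + T) := by
  obtain ⟨s, t, rfl⟩ := hS
  obtain ⟨s', t', rfl⟩ := hT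
  exact ⟨_, _, by simp [Matrix.fromBlocks_add]; exact ⟨rfl, rfl⟩⟩

theorem IsOddSpin.add {S T : Matrix SpinIx SpinIx ℂ} (hS : IsOddSpin S) (hT : IsOddSpin T) :
    IsOddSpin (S + T) := by
  obtain ⟨s, t, rfl⟩ := hS
  obtain ⟨s', t', rfl⟩ := hT
  exact ⟨_, _, by simp [Matrix.fromBlocks_add]; exact ⟨rfl, rfl⟩⟩

theorem IsEvenSpin.smul {S : Matrix SpinIx SpinIx ℂ} (r : ℂ) (hS : IsEvenSpin S) :
    IsEvenSpin (r • S) := by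
  obtain ⟨s, t, rfl⟩ := hS
  exact ⟨_, _, by simp [Matrix.fromBlocks_smul]; exact ⟨rfl, rfl⟩⟩

theorem IsOddSpin.smul {S : Matrix SpinIx SpinIx ℂ} (r : ℂ) (hS : IsOddSpin S) :
    IsOddSpin (r • S) := by
  obtain ⟨s, t, rfl⟩ := hS
  exact ⟨_, _, by simp [Matrix.fromBlocks_smul]; exact ⟨rfl, rfl⟩⟩

theorem isOddSpin_zero : IsOddSpin 0 := ⟨0, 0, by simp⟩

theorem isEvenSpin_zero : IsEvenSpin 0 := ⟨0, 0, by simp⟩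

theorem isEvenSpin_one : IsEvenSpin 1 := ⟨1, 1, by simp⟩

theorem isOddSpin_sum {κ : Type*} (s : Finset κ) (T : κ → Matrix SpinIx SpinIx ℂ)
    (h : ∀ k, IsOddSpin (T k)) : IsOddSpin (∑ k ∈ s, T k) :=
  Finset.sum_induction _ _ (fun _ _ => IsOddSpin.add) isOddSpin_zero fun k _ => h k

theorem isEvenSpin_sum {κ : Type*} (s : Finset κ) (T : κ → Matrix SpinIx SpinIx ℂ)
    (h : ∀ k, IsEvenSpin (T k)) : IsEvenSpin (∑ k ∈ s, T k) :=
  Finset.sum_induction _ _ (fun _ _ => IsEvenSpin.add) isEvenSpin_zero fun k _ => h k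

theorem isOddSpin_cliffE (v : Fin 4 → ℝ) : IsOddSpin (cliffE v) :=
  isOddSpin_sum _ _ fun k => (isOddSpin_gammaE k).smul _

theorem isEvenSpin_of_mem_spin4 {h : Matrix SpinIx SpinIx ℂ} (hh : h ∈ spin4) :
    IsEvenSpin h := by
  induction hh using Submonoid.closure_induction with
  | mem h hh =>
    obtain ⟨v, w, -, -, rfl⟩ := hh
    exact (isOddSpin_cliffE v).mul (isOddSpin_cliffE w)
  | one => exact isEvenSpin_one
  | mul _ _ _ _ h₁ h₂ => exact h₁.mul h₂

theorem gammaE_conjTranspose (k : Fin 4) : (gammaE k)ᴴ = gammaE k := by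
  ext i j
  rcases i with i | i <;> rcases j with j | j <;> fin_cases k <;> fin_cases i <;> fin_cases j <;>
    simp [gammaE, sigma, sigmaTilde, pauli]

theorem cliffE_conjTranspose (v : Fin 4 → ℝ) : (cliffE v)ᴴ = cliffE v := by
  simp [cliffE, Matrix.conjTranspose_sum, Matrix.conjTranspose_smul, gammaE_conjTranspose]

theorem cliffE_mul_self (v : Fin 4 → ℝ) : cliffE v * cliffE v = ((∑ k, v k ^ 2 : ℝ) : ℂ) • 1 := by
  ext i j
  rcases i with i | i <;> rcases j with j | j <;> fin_cases i <;> fin_cases j <;>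
    simp [cliffE, gammaE, sigma, sigmaTilde, pauli, Matrix.mul_apply, Fin.sum_univ_four] <;>
    ring_nf <;> simp <;> ring

theorem conjTranspose_mul_self_of_mem_spin4 {h : Matrix SpinIx SpinIx ℂ} (hh : h ∈ spin4) :
    hᴴ * h = 1 := by
  induction hh using Submonoid.closure_induction with
  | mem h hh =>
    obtain ⟨v, w, hv, hw, rfl⟩ := hh
    rw [Matrix.conjTranspose_mul, cliffE_conjTranspose, cliffE_conjTranspose, mul_assoc,
      ← mul_assoc (cliffE v), cliffE_mul_self, hv]
    simp [cliffE_mul_self, hw]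
  | one => simp
  | mul g h _ _ hg hh =>
    rw [Matrix.conjTranspose_mul, mul_assoc, ← mul_assoc _ g, hg, one_mul, hh]

/-! ### The real structure -/

/-- The charge conjugation anticommutes with the Dirac matrices; hence `J` commutes with the `-i
γ^c`, the factor `-i` being conjugated too. -/
theorem chargeConj_mul_conjMat_gammaE (k : Fin 4) :
    chargeConj * conjMat (gammaE k) = -(gammaE k * chargeConj) := by
  ext i j
  rcases i with i | i <;> rcases j with j | j <;> fin_cases k <;> fin_cases i <;> fin_cases j <;>
    simp [chargeConj, conjMat, gammaE, sigma, sigmaTilde, pauli, Matrix.mul_apply]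

theorem isEvenSpin_chargeConj : IsEvenSpin chargeConj :=
  ((isOddSpin_gammaE 0).mul (isOddSpin_gammaE 2)).smul _

theorem realStructureMat_mul_spinLift (k : Fin 4) :
    realStructureMat * conjMat (spinLift (gammaE k))
      = -(spinLift (gammaE k) * realStructureMat) := by
  have h : -(gammaE k * chargeConj) ⊗ₖ (1 : Matrix Internal Internal ℂ)
      = (-(gammaE k * chargeConj)) ⊗ₖ (1 : Matrix Internal Internal ℂ) := by
    ext i j
    simp [Matrix.kroneckerMap_apply]
  rw [conjMat_spinLift]
  simp [realStructureMat, spinLift, Matrix.fromBlocks_multiply, ← Matrix.mul_kronecker_mul,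
    chargeConj_mul_conjMat_gammaE, Matrix.fromBlocks_neg, h]

theorem realStructureMat_mul_blockMat (Qr Ql Mr Ml : Matrix Internal Internal ℂ) :
    realStructureMat * blockMat Qr Ql Mr Ml = blockMat Mr Ml Qr Ql * realStructureMat := by
  simp [realStructureMat, blockMat, Matrix.fromBlocks_multiply, isEvenSpin_chargeConj.mul_chiral]

theorem star_mulVec_eq {m n : Type*} [Fintype n] (A : Matrix m n ℂ) (v : n → ℂ) :
    star (A *ᵥ v) = conjMat A *ᵥ star v := by
  ext i
  simp [Matrix.mulVec, dotProduct, conjMat]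

/-- How a linear operator is transported through the antilinear real structure. -/
theorem realStructureFun_mulVec (A B : Matrix Full Full ℂ)
    (h : realStructureMat * conjMat A = B * realStructureMat) (v : Full → ℂ) :
    realStructureFun (A *ᵥ v) = B *ᵥ realStructureFun v := by
  rw [realStructureFun, realStructureFun, star_mulVec_eq, Matrix.mulVec_mulVec, h,
    Matrix.mulVec_mulVec]

/-! ### The representation on the fibres -/

/-- The real vector space underlying `ℂ ⊕ ℍ ⊕ M₃(ℂ)`. The matrices are written as families of
complex numbers, since these carry a norm. -/
abbrev Fibre : Type := ℂ × ℍ[ℝ] × (Fin 3 → Fin 3 → ℂ)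

/-- The particle block of the representation of `(u, u')` in one chirality. -/
def particleBlock (u u' : Fibre) : Matrix Internal Internal ℂ := particleRep u.1 u'.2.1

/-- The antiparticle block of the representation of `(u, u')` in one chirality. -/
def antiparticleBlock (u u' : Fibre) : Matrix Internal Internal ℂ :=
  colourRep u.1 (Matrix.of u.2.2) ⊗ₖ dotted + colourRep u'.1 (Matrix.of u'.2.2) ⊗ₖ undotted

/-- The representation of a pair of elements of `ℂ ⊕ ℍ ⊕ M₃(ℂ)`, on one fibre. -/
def fibreRep (u u' : Fibre) : Matrix Full Full ℂ :=
  blockMat (particleBlock u u') (particleBlock u' u)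
    (antiparticleBlock u u') (antiparticleBlock u' u)

/-- The product of `ℂ ⊕ ℍ ⊕ M₃(ℂ)`. -/
noncomputable def fibreMul (u w : Fibre) : Fibre :=
  (u.1 * w.1, u.2.1 * w.2.1, fun i j => ∑ k, u.2.2 i k * w.2.2 k j)

theorem quatMat_add (p q : ℍ[ℝ]) : quatMat (p + q) = quatMat p + quatMat q := by
  ext i j
  fin_cases i <;> fin_cases j <;> apply Complex.ext <;> simp [quatMat] <;> ring

theorem quatMat_smul (r : ℝ) (q : ℍ[ℝ]) : quatMat (r • q) = (r : ℂ) • quatMat q := by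
  ext i j
  fin_cases i <;> fin_cases j <;> apply Complex.ext <;> simp [quatMat]

theorem quatMat_mul (p q : ℍ[ℝ]) : quatMat (p * q) = quatMat p * quatMat q := by
  ext i j
  fin_cases i <;> fin_cases j <;> apply Complex.ext <;>
    simp [quatMat, Matrix.mul_apply, Fin.sum_univ_two] <;> ring

theorem quatMat_star (q : ℍ[ℝ]) : quatMat (star q) = (quatMat q)ᴴ := by
  ext i j
  fin_cases i <;> fin_cases j <;> apply Complex.ext <;> simp [quatMat]

theorem quatMat_injective : Function.Injective quatMat := by
  intro p q h
  have h0 := congrFun (congrFun h 0) 0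
  have h1 := congrFun (congrFun h 0) 1
  simp only [quatMat, Matrix.cons_val', Matrix.cons_val_zero, Matrix.cons_val_one,
    Matrix.of_apply, Complex.mk.injEq, Matrix.cons_val_fin_one] at h0 h1
  exact QuaternionAlgebra.ext h0.1 h0.2 h1.1 h1.2

theorem diag_add (c d : ℂ) :
    (!![c + d, 0; 0, star (c + d)] : Matrix (Fin 2) (Fin 2) ℂ)
      = !![c, 0; 0, star c] + !![d, 0; 0, star d] := by
  ext i j
  fin_cases i <;> fin_cases j <;> simp

theorem flavourRep_add (c d : ℂ) (p q : ℍ[ℝ]) :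
    flavourRep (c + d) (p + q) = flavourRep c p + flavourRep d q := by
  simp only [flavourRep, quatMat_add, diag_add, Matrix.fromBlocks_add, add_zero]

theorem flavourRep_smul (r : ℝ) (c : ℂ) (q : ℍ[ℝ]) :
    flavourRep (r * c) (r • q) = (r : ℂ) • flavourRep c q := by
  simp only [flavourRep, quatMat_smul, Matrix.fromBlocks_smul, smul_zero]
  congr 1
  ext i j
  fin_cases i <;> fin_cases j <;> simp

theorem flavourRep_mul (c d : ℂ) (p q : ℍ[ℝ]) :
    flavourRep (c * d) (p * q) = flavourRep c p * flavourRep d q := by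
  simp only [flavourRep, quatMat_mul, Matrix.fromBlocks_multiply, Matrix.zero_mul,
    Matrix.mul_zero, add_zero, zero_add]
  congr 1
  ext i j
  fin_cases i <;> fin_cases j <;> simp [Matrix.mul_apply, mul_comm]

theorem flavourRep_star (c : ℂ) (q : ℍ[ℝ]) :
    (flavourRep c q)ᴴ = flavourRep (star c) (star q) := by
  simp only [flavourRep, Matrix.fromBlocks_conjTranspose, Matrix.conjTranspose_zero, quatMat_star]
  congr 1
  ext i j
  fin_cases i <;> fin_cases j <;> simp

theorem flavourRep_inj {c d : ℂ} {p q : ℍ[ℝ]} (h : flavourRep c p = flavourRep d q) :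
    c = d ∧ p = q := by
  obtain ⟨h₁, -, -, h₂⟩ := Matrix.fromBlocks_inj.1 h
  exact ⟨by simpa using congrFun (congrFun h₁ 0) 0, quatMat_injective h₂⟩

theorem colourRep_add (c d : ℂ) (m n : Matrix (Fin 3) (Fin 3) ℂ) :
    colourRep (c + d) (m + n) = colourRep c m + colourRep d n := by
  simp [colourRep, Matrix.fromBlocks_add, add_smul]

theorem colourRep_smul (r c : ℂ) (m : Matrix (Fin 3) (Fin 3) ℂ) :
    colourRep (r * c) (r • m) = r • colourRep c m := by
  simp [colourRep, Matrix.fromBlocks_smul, mul_smul]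

theorem colourRep_mul (c d : ℂ) (m n : Matrix (Fin 3) (Fin 3) ℂ) :
    colourRep (c * d) (m * n) = colourRep c m * colourRep d n := by
  simp [colourRep, Matrix.fromBlocks_multiply, mul_smul, smul_comm c d]

theorem colourRep_star (c : ℂ) (m : Matrix (Fin 3) (Fin 3) ℂ) :
    (colourRep c m)ᴴ = colourRep (star c) mᴴ := by
  simp [colourRep, Matrix.fromBlocks_conjTranspose]

theorem particleBlock_add (u u' w w' : Fibre) :
    particleBlock (u + w) (u' + w') = particleBlock u u' + particleBlock w w' := by
  simp [particleBlock, particleRep, flavourRep_add, Matrix.kronecker_add]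

theorem particleBlock_smul (r : ℝ) (u u' : Fibre) :
    particleBlock (r • u) (r • u') = (r : ℂ) • particleBlock u u' := by
  simp [particleBlock, particleRep, flavourRep_smul, Matrix.kronecker_smul]

theorem particleBlock_mul (u u' w w' : Fibre) :
    particleBlock (fibreMul u w) (fibreMul u' w') = particleBlock u u' * particleBlock w w' := by
  simp [particleBlock, particleRep, flavourRep_mul, fibreMul, ← Matrix.mul_kronecker_mul]

theorem dotted_mul_dotted : dotted * dotted = dotted := by
  simp [dotted, Matrix.fromBlocks_multiply]

theorem undotted_mul_undotted : undotted * undotted = undotted := by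
  simp [undotted, Matrix.fromBlocks_multiply]

theorem dotted_mul_undotted : dotted * undotted = 0 := by
  simp [dotted, undotted, Matrix.fromBlocks_multiply]

theorem undotted_mul_dotted : undotted * dotted = 0 := by
  simp [dotted, undotted, Matrix.fromBlocks_multiply]

theorem antiparticleBlock_add (u u' w w' : Fibre) :
    antiparticleBlock (u + w) (u' + w') = antiparticleBlock u u' + antiparticleBlock w w' := by
  have h (a b : Fin 3 → Fin 3 → ℂ) : Matrix.of (a + b) = Matrix.of a + Matrix.of b := rfl
  simp only [antiparticleBlock, Prod.fst_add, Prod.snd_add, h, colourRep_add,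
    Matrix.add_kronecker]
  abel

theorem antiparticleBlock_smul (r : ℝ) (u u' : Fibre) :
    antiparticleBlock (r • u) (r • u') = (r : ℂ) • antiparticleBlock u u' := by
  have h (a : Fin 3 → Fin 3 → ℂ) : Matrix.of (r • a) = (r : ℂ) • Matrix.of a := by
    ext i j
    simp
  simp only [antiparticleBlock, Prod.smul_fst, Prod.smul_snd, h, Complex.real_smul,
    colourRep_smul, Matrix.smul_kronecker, smul_add]

theorem antiparticleBlock_mul (u u' w w' : Fibre) :
    antiparticleBlock (fibreMul u w) (fibreMul u' w')
      = antiparticleBlock u u' * antiparticleBlock w w' := by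
  have h (a b : Fin 3 → Fin 3 → ℂ) :
      Matrix.of (fun i j => ∑ k, a i k * b k j) = Matrix.of a * Matrix.of b := by
    ext i j
    simp [Matrix.mul_apply]
  simp only [antiparticleBlock, fibreMul, h, colourRep_mul, add_mul, mul_add,
    ← Matrix.mul_kronecker_mul, dotted_mul_dotted, dotted_mul_undotted, undotted_mul_dotted,
    undotted_mul_undotted, Matrix.kronecker_zero, add_zero, zero_add]

theorem fibreRep_mul (u u' w w' : Fibre) :
    fibreRep (fibreMul u w) (fibreMul u' w') = fibreRep u u' * fibreRep w w' := by
  simp only [fibreRep, blockMat_mul, particleBlock_mul, antiparticleBlock_mul]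

/-- `fibreRep` as a real-linear map. -/
def fibreRepLin : Fibre × Fibre →ₗ[ℝ] Matrix Full Full ℂ where
  toFun u := fibreRep u.1 u.2
  map_add' u w := by
    simp only [fibreRep, Prod.fst_add, Prod.snd_add, particleBlock_add, antiparticleBlock_add,
      blockMat_add]
  map_smul' r u := by
    simp only [fibreRep, Prod.smul_fst, Prod.smul_snd, particleBlock_smul, antiparticleBlock_smul,
      blockMat_smul, RingHom.id_apply]
    exact Complex.coe_smul _ _

theorem fibreRepLin_apply (u : Fibre × Fibre) : fibreRepLin u = fibreRep u.1 u.2 := rfl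

/-- Multiplication by odd spinor matrices twists the representation. -/
theorem IsOddSpin.spinLift_mul_fibreRep {T : Matrix SpinIx SpinIx ℂ} (hT : IsOddSpin T)
    (u u' : Fibre) : spinLift T * fibreRep u u' = fibreRep u' u * spinLift T :=
  hT.spinLift_mul_blockMat _ _ _ _

theorem IsEvenSpin.spinLift_mul_fibreRep {T : Matrix SpinIx SpinIx ℂ} (hT : IsEvenSpin T)
    (u u' : Fibre) : spinLift T * fibreRep u u' = fibreRep u u' * spinLift T :=
  hT.spinLift_mul_blockMat _ _ _ _

/-! ### Derivatives in tangent directions -/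

section Derivatives

variable {M : Type*} [TopologicalSpace M] [ChartedSpace E4 M]
  {F G : Type*} [NormedAddCommGroup F] [NormedSpace ℝ F] [NormedAddCommGroup G] [NormedSpace ℝ G]

theorem dirDeriv_vec_add (f : M → F) (x : M) (u v : TangentSpace (𝓡 4) x) :
    dirDeriv f x (u + v) = dirDeriv f x u + dirDeriv f x v :=
  map_add (mfderiv (𝓡 4) 𝓘(ℝ, F) f x) u v

theorem dirDeriv_vec_smul (f : M → F) (x : M) (r : ℝ) (v : TangentSpace (𝓡 4) x) :
    dirDeriv f x (r • v) = r • dirDeriv f x v :=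
  map_smul (mfderiv (𝓡 4) 𝓘(ℝ, F) f x) r v

theorem dirDeriv_linear [FiniteDimensional ℝ F] (L : F →ₗ[ℝ] G) {f : M → F} {x : M}
    (hf : MDifferentiableAt (𝓡 4) 𝓘(ℝ, F) f x) (v : TangentSpace (𝓡 4) x) :
    dirDeriv (fun y => L (f y)) x v = L (dirDeriv f x v) := by
  have h := (L.toContinuousLinearMap.hasMFDerivAt (x := f x)).comp x hf.hasMFDerivAt
  have h' : mfderiv (𝓡 4) 𝓘(ℝ, G) (fun y => L (f y)) x = _ := h.mfderiv
  rw [dirDeriv, h']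
  rfl

theorem mdifferentiableAt_linear [FiniteDimensional ℝ F] (L : F →ₗ[ℝ] G) {f : M → F} {x : M}
    (hf : MDifferentiableAt (𝓡 4) 𝓘(ℝ, F) f x) :
    MDifferentiableAt (𝓡 4) 𝓘(ℝ, G) (fun y => L (f y)) x :=
  ((L.toContinuousLinearMap.hasMFDerivAt (x := f x)).comp x hf.hasMFDerivAt).mdifferentiableAt

theorem dirDeriv_mul {f g : M → ℂ} {x : M} (hf : MDifferentiableAt (𝓡 4) 𝓘(ℝ, ℂ) f x)
    (hg : MDifferentiableAt (𝓡 4) 𝓘(ℝ, ℂ) g x) (v : TangentSpace (𝓡 4) x) :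
    dirDeriv (fun y => f y * g y) x v = dirDeriv f x v * g x + f x * dirDeriv g x v := by
  have h := (hf.hasMFDerivAt.mul hg.hasMFDerivAt).mfderiv
  have h' : mfderiv (𝓡 4) 𝓘(ℝ, ℂ) (fun y => f y * g y) x = _ := h
  rw [dirDeriv, h', add_comm (dirDeriv f x v * g x), mul_comm (dirDeriv f x v), add_comm]
  exact add_comm _ _

theorem dirDeriv_sum {κ : Type} (s : Finset κ) {f : κ → M → F} {x : M}
    (hf : ∀ k, MDifferentiableAt (𝓡 4) 𝓘(ℝ, F) (f k) x) (v : TangentSpace (𝓡 4) x) :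
    dirDeriv (fun y => ∑ k ∈ s, f k y) x v = ∑ k ∈ s, dirDeriv (f k) x v := by
  have h : HasMFDerivAt (𝓡 4) 𝓘(ℝ, F) (∑ k ∈ s, f k) x
      (∑ k ∈ s, (mfderiv (𝓡 4) 𝓘(ℝ, F) (f k) x : TangentSpace (𝓡 4) x →L[ℝ] F)) :=
    HasMFDerivAt.sum fun k _ => (hf k).hasMFDerivAt
  have h' : (fun y => ∑ k ∈ s, f k y) = ∑ k ∈ s, f k := by
    ext y
    simp
  rw [h', dirDeriv, h.mfderiv]
  simp only [dirDeriv]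
  exact sum_apply _ _ _

theorem mdifferentiableAt_pi {κ : Type*} [Fintype κ] {f : M → κ → F} {x : M}
    (hf : ∀ p, MDifferentiableAt (𝓡 4) 𝓘(ℝ, F) (fun y => f y p) x) :
    MDifferentiableAt (𝓡 4) 𝓘(ℝ, κ → F) f x := by
  exact ⟨continuousWithinAt_pi.2 fun p => (hf p).1, differentiableWithinAt_pi.2 fun p => (hf p).2⟩

end Derivatives

/-! ### Free one-forms as matrix-valued functions -/

section OneForms

variable {M : Type*} [TopologicalSpace M] [ChartedSpace E4 M]

/-- The value at `x` of an element of `C^∞(M) ⊗ (ℂ ⊕ ℍ ⊕ M₃(ℂ))`. -/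
noncomputable def SMFunction.fibre (f : SMFunction M) (x : M) : Fibre := (f.c x, f.q x, f.mAt x)

/-- The value at `x` of an element of the twisted algebra. -/
noncomputable def pairFibre (a : TwistedAlgebra M) (x : M) : Fibre × Fibre :=
  (a.1.fibre x, a.2.fibre x)

theorem rep_eq (a : TwistedAlgebra M) (x : M) : rep a x = fibreRepLin (pairFibre a x) := rfl

theorem rep_rho (a : TwistedAlgebra M) (x : M) :
    rep (rho a) x = fibreRep (a.2.fibre x) (a.1.fibre x) := rfl

theorem IsOddSpin.spinLift_mul_rep {T : Matrix SpinIx SpinIx ℂ} (hT : IsOddSpin T)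
    (a : TwistedAlgebra M) (x : M) : spinLift T * rep a x = rep (rho a) x * spinLift T := by
  rw [rep_rho, rep_eq, fibreRepLin_apply]
  exact hT.spinLift_mul_fibreRep (a.1.fibre x) (a.2.fibre x)

theorem IsOddSpin.spinLift_mul_rep_rho {T : Matrix SpinIx SpinIx ℂ} (hT : IsOddSpin T)
    (a : TwistedAlgebra M) (x : M) : spinLift T * rep (rho a) x = rep a x * spinLift T := by
  rw [rep_rho, rep_eq, fibreRepLin_apply]
  exact hT.spinLift_mul_fibreRep (a.2.fibre x) (a.1.fibre x)

theorem IsEvenSpin.spinLift_mul_rep {T : Matrix SpinIx SpinIx ℂ} (hT : IsEvenSpin T)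
    (a : TwistedAlgebra M) (x : M) : spinLift T * rep a x = rep a x * spinLift T := by
  rw [rep_eq, fibreRepLin_apply]
  exact hT.spinLift_mul_fibreRep (a.1.fibre x) (a.2.fibre x)

theorem SMFunction.mdifferentiableAt_fibre (f : SMFunction M) (x : M) :
    MDifferentiableAt (𝓡 4) 𝓘(ℝ, Fibre) f.fibre x := by
  have hc := f.c.mdifferentiableAt (x := x)
  have hq := f.q.mdifferentiableAt (x := x)
  have hm : MDifferentiableAt (𝓡 4) 𝓘(ℝ, Fin 3 → Fin 3 → ℂ) (fun y i j => f.m i j y) x :=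
    mdifferentiableAt_pi fun i => mdifferentiableAt_pi fun j => (f.m i j).mdifferentiableAt
  exact hc.prodMk_space (hq.prodMk_space hm)

theorem mdifferentiableAt_pairFibre (a : TwistedAlgebra M) (x : M) :
    MDifferentiableAt (𝓡 4) 𝓘(ℝ, Fibre × Fibre) (pairFibre a) x :=
  (a.1.mdifferentiableAt_fibre x).prodMk_space (a.2.mdifferentiableAt_fibre x)

theorem SMFunction.dirDeriv_fibre (f : SMFunction M) (x : M) (v : TangentSpace (𝓡 4) x) :
    dirDeriv f.fibre x v = (dirDeriv f.c x v, dirDeriv f.q x v, matDeriv f.mAt x v) := by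
  have h := f.mdifferentiableAt_fibre x
  refine Prod.ext ?_ (Prod.ext ?_ ?_)
  · exact (dirDeriv_linear (LinearMap.fst ℝ _ _) h v).symm
  · exact (dirDeriv_linear (LinearMap.fst ℝ _ _ ∘ₗ LinearMap.snd ℝ _ _) h v).symm
  · funext i j
    exact (dirDeriv_linear (LinearMap.proj j ∘ₗ LinearMap.proj i ∘ₗ LinearMap.snd ℝ _ _ ∘ₗ
      LinearMap.snd ℝ _ _ : Fibre →ₗ[ℝ] ℂ) h v).symm

theorem dirDeriv_pairFibre (a : TwistedAlgebra M) (x : M) (v : TangentSpace (𝓡 4) x) :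
    dirDeriv (pairFibre a) x v = (dirDeriv a.1.fibre x v, dirDeriv a.2.fibre x v) := by
  have h := mdifferentiableAt_pairFibre a x
  exact Prod.ext (dirDeriv_linear (LinearMap.fst ℝ _ _) h v).symm
    (dirDeriv_linear (LinearMap.snd ℝ _ _) h v).symm

theorem matDeriv_rep (a : TwistedAlgebra M) (x : M) (v : TangentSpace (𝓡 4) x) :
    matDeriv (rep a) x v = fibreRep (dirDeriv a.1.fibre x v) (dirDeriv a.2.fibre x v) := by
  have h := dirDeriv_pairFibre a x v
  ext p q
  have h' := dirDeriv_linear (Matrix.entryLinearMap ℝ ℂ p q ∘ₗ fibreRepLin)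
    (mdifferentiableAt_pairFibre a x) v
  rw [h] at h'
  exact h'

theorem mdifferentiableAt_rep (a : TwistedAlgebra M) (x : M) (p q : Full) :
    MDifferentiableAt (𝓡 4) 𝓘(ℝ, ℂ) (fun y => rep a y p q) x := by
  have h := mdifferentiableAt_linear (Matrix.entryLinearMap ℝ ℂ p q ∘ₗ fibreRepLin)
    (mdifferentiableAt_pairFibre a x)
  exact h

variable {n : ℕ}

/-- The right-handed part of the component `A_μ` of a free one-form: the component with values in
`ℂ ⊕ ℍ ⊕ M₃(ℂ)` whose complex entry acts on right-handed particles. In the twisted algebra its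
quaternion acts on the left-handed ones. The left-handed part of `A_μ` is the right-handed part of
the twisted free one-form. -/
noncomputable def formFibre (a b : Fin n → TwistedAlgebra M) (x : M)
    (v : TangentSpace (𝓡 4) x) : Fibre :=
  (cRight a b x v, qRight (rho ∘ a) (rho ∘ b) x v, mRight a b x v)

theorem formFibre_eq_sum (a b : Fin n → TwistedAlgebra M) (x : M) (v : TangentSpace (𝓡 4) x) :
    formFibre a b x v
      = ∑ k, fibreMul ((a k).2.fibre x) (dirDeriv (b k).1.fibre x v) := by
  refine Prod.ext ?_ (Prod.ext ?_ ?_)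
  · rw [Prod.fst_sum]
    simp only [SMFunction.dirDeriv_fibre]
    rfl
  · rw [Prod.snd_sum, Prod.fst_sum]
    simp only [SMFunction.dirDeriv_fibre]
    rfl
  · rw [Prod.snd_sum, Prod.snd_sum]
    simp only [SMFunction.dirDeriv_fibre]
    funext i j
    rw [Finset.sum_apply, Finset.sum_apply]
    simp only [formFibre, mRight, Matrix.sum_apply, Matrix.mul_apply]
    rfl

theorem formComponent_eq (a b : Fin n → TwistedAlgebra M) (x : M) (v : TangentSpace (𝓡 4) x) :
    formComponent a b x v
      = fibreRep (formFibre a b x v) (formFibre (rho ∘ a) (rho ∘ b) x v) := by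
  have h : (formFibre a b x v, formFibre (rho ∘ a) (rho ∘ b) x v)
      = ∑ k, (fibreMul ((a k).2.fibre x) (dirDeriv (b k).1.fibre x v),
        fibreMul ((a k).1.fibre x) (dirDeriv (b k).2.fibre x v)) := by
    refine Prod.ext ?_ ?_
    · rw [Prod.fst_sum]
      exact formFibre_eq_sum a b x v
    · rw [Prod.snd_sum]
      exact formFibre_eq_sum (rho ∘ a) (rho ∘ b) x v
  have h' := fibreRepLin_apply (formFibre a b x v, formFibre (rho ∘ a) (rho ∘ b) x v)
  rw [← h', h, map_sum]
  refine Finset.sum_congr rfl fun k _ => ?_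
  rw [rep_rho, matDeriv_rep, ← fibreRep_mul]
  rfl

theorem formFibre_add (a b : Fin n → TwistedAlgebra M) (x : M) (u v : TangentSpace (𝓡 4) x) :
    formFibre a b x (u + v) = formFibre a b x u + formFibre a b x v := by
  simp only [formFibre_eq_sum, dirDeriv_vec_add, ← Finset.sum_add_distrib]
  refine Finset.sum_congr rfl fun k _ => ?_
  refine Prod.ext (mul_add _ _ _) (Prod.ext (mul_add _ _ _) ?_)
  funext i j
  simp [fibreMul, mul_add, Finset.sum_add_distrib]

theorem formFibre_smul (a b : Fin n → TwistedAlgebra M) (x : M) (r : ℝ)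
    (v : TangentSpace (𝓡 4) x) : formFibre a b x (r • v) = r • formFibre a b x v := by
  simp only [formFibre_eq_sum, dirDeriv_vec_smul, Finset.smul_sum]
  refine Finset.sum_congr rfl fun k _ => ?_
  refine Prod.ext (mul_smul_comm _ _ _) (Prod.ext (mul_smul_comm _ _ _) ?_)
  funext i j
  simp only [fibreMul, Prod.smul_snd, Pi.smul_apply, Finset.smul_sum, mul_smul_comm]

theorem formComponent_add (a b : Fin n → TwistedAlgebra M) (x : M) (u v : TangentSpace (𝓡 4) x) :
    formComponent a b x (u + v) = formComponent a b x u + formComponent a b x v := by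
  simp only [formComponent_eq, formFibre_add]
  exact map_add fibreRepLin (_, _) (_, _)

theorem formComponent_smul (a b : Fin n → TwistedAlgebra M) (x : M) (r : ℝ)
    (v : TangentSpace (𝓡 4) x) :
    formComponent a b x (r • v) = (r : ℂ) • formComponent a b x v := by
  simp only [formComponent_eq, formFibre_smul]
  refine (map_smul fibreRepLin r (_, _)).trans ?_
  exact (Complex.coe_smul _ _).symm

/-! ### The action of free one-forms on spinors -/

/-- One summand of `D (B ψ)`: the derivative of `B` survives, and the remaining terms are `B'`
applied to the corresponding summand of `D ψ`. Here `γ` is a Dirac matrix, which twists `B` into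
`B'`, `Γ` is the spin connection and `d` is the derivative of `ψ`. -/
theorem mulVec_twisted_leibniz {m : Type*} [Fintype m] {γ Γ B B' : Matrix m m ℂ}
    (h : γ * B = B' * γ) (hΓ : Γ * B = B * Γ) (dB : Matrix m m ℂ) (d u : m → ℂ) :
    γ *ᵥ (dB *ᵥ u + B *ᵥ d + Γ *ᵥ (B *ᵥ u)) = (γ * dB) *ᵥ u + B' *ᵥ (γ *ᵥ (d + Γ *ᵥ u)) := by
  simp only [Matrix.mulVec_add, Matrix.mulVec_mulVec, hΓ]
  rw [← mul_assoc, ← mul_assoc, ← h, mul_assoc γ B Γ, add_assoc]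

theorem dirac_twisted_leibniz {m κ : Type*} [Fintype m] (s : Finset κ)
    {γ Γ dB : κ → Matrix m m ℂ} {B B' : Matrix m m ℂ} (h : ∀ c, γ c * B = B' * γ c)
    (hΓ : ∀ c, Γ c * B = B * Γ c) (d : κ → m → ℂ) (u : m → ℂ) (z : ℂ) :
    z • (∑ c ∈ s, γ c *ᵥ (dB c *ᵥ u + B *ᵥ d c + Γ c *ᵥ (B *ᵥ u)))
        - B' *ᵥ (z • ∑ c ∈ s, γ c *ᵥ (d c + Γ c *ᵥ u))
      = (z • ∑ c ∈ s, γ c * dB c) *ᵥ u := by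
  rw [Finset.sum_congr rfl fun c _ => mulVec_twisted_leibniz (h c) (hΓ c) (dB c) (d c) u,
    Finset.sum_add_distrib, smul_add, Matrix.mulVec_smul, Matrix.mulVec_sum,
    Matrix.smul_mulVec, Matrix.sum_mulVec, add_sub_cancel_right]

theorem dirDeriv_rep_mulVec (b : TwistedAlgebra M) {ψ : M → Full → ℂ} {x : M}
    (hψ : ∀ p, MDifferentiableAt (𝓡 4) 𝓘(ℝ, ℂ) (fun y => ψ y p) x) (v : TangentSpace (𝓡 4) x) :
    (fun p => dirDeriv (fun y => (rep b y *ᵥ ψ y) p) x v)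
      = matDeriv (rep b) x v *ᵥ ψ x + rep b x *ᵥ fun p => dirDeriv (fun y => ψ y p) x v := by
  funext p
  have h := dirDeriv_sum (Finset.univ : Finset Full) (f := fun q y => rep b y p q * ψ y q)
    (fun q => (mdifferentiableAt_rep b x p q).mul (hψ q)) v
  refine h.trans ?_
  simp only [dirDeriv_mul (mdifferentiableAt_rep b x p _) (hψ _), Finset.sum_add_distrib]
  rfl

variable [IsManifold (𝓡 4) ∞ M] [RiemannianBundle (fun x : M => TangentSpace (𝓡 4) x)]
  {ι : Type*}

/-- The matrix `-i Σ_c γ^c A(e_c)` by which a free one-form acts on the fibre over `x`, in the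
orthonormal frame of a patch. -/
noncomputable def oneFormMat (S : SpinStructure M ι) (a b : Fin n → TwistedAlgebra M) (i : ι)
    (x : M) : Matrix Full Full ℂ :=
  -Complex.I • ∑ c, spinLift (gammaE c) * formComponent a b x (S.frame i c x)

theorem isEvenSpin_spinConnection (S : SpinStructure M ι) (i : ι) (c : Fin 4) (x : M) :
    IsEvenSpin (spinConnection S i c x) :=
  (isEvenSpin_sum _ _ fun a => isEvenSpin_sum _ _ fun b =>
    ((isOddSpin_gammaE a).mul (isOddSpin_gammaE b)).smul _).smul _

/-- The unbounded parts of `D b` and `ρ(b) D` cancel, since the Dirac matrices twist the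
representation and the spin connection commutes with it. -/
theorem twistedCommutator_apply (S : SpinStructure M ι) (b : TwistedAlgebra M)
    (ψ : LocalSpinor M ι) (i : ι) (x : M)
    (hψ : ∀ p, MDifferentiableAt (𝓡 4) 𝓘(ℝ, ℂ) (fun y => ψ i y p) x) :
    twistedCommutator S b ψ i x
      = (-Complex.I • ∑ c, spinLift (gammaE c) * matDeriv (rep b) x (S.frame i c x))
        *ᵥ ψ i x := by
  have h (c : Fin 4) : spinLift (gammaE c) * rep b x = rep (rho b) x * spinLift (gammaE c) :=
    (isOddSpin_gammaE c).spinLift_mul_rep b x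
  have hΓ (c : Fin 4) : spinLift (spinConnection S i c x) * rep b x
      = rep b x * spinLift (spinConnection S i c x) :=
    (isEvenSpin_spinConnection S i c x).spinLift_mul_rep b x
  rw [← dirac_twisted_leibniz Finset.univ h hΓ
    (fun c p => dirDeriv (fun y => ψ i y p) x (S.frame i c x)) (ψ i x) (-Complex.I)]
  simp only [← dirDeriv_rep_mulVec b hψ]
  rfl

/-- A free one-form is an operator of order zero. -/
theorem freeOneForm_apply (S : SpinStructure M ι) (a b : Fin n → TwistedAlgebra M)
    (ψ : LocalSpinor M ι) (i : ι) (x : M)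
    (hψ : ∀ p, MDifferentiableAt (𝓡 4) 𝓘(ℝ, ℂ) (fun y => ψ i y p) x) :
    freeOneForm S a b ψ i x = oneFormMat S a b i x *ᵥ ψ i x := by
  have h (c : Fin 4) (k : Fin n) :
      spinLift (gammaE c) * rep (rho (a k)) x = rep (a k) x * spinLift (gammaE c) :=
    (isOddSpin_gammaE c).spinLift_mul_rep_rho (a k) x
  have h' : oneFormMat S a b i x = ∑ k, rep (a k) x *
      (-Complex.I • ∑ c, spinLift (gammaE c) * matDeriv (rep (b k)) x (S.frame i c x)) := by
    simp only [oneFormMat, formComponent, Finset.mul_sum, Finset.smul_sum, mul_smul_comm]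
    rw [Finset.sum_comm]
    simp only [← mul_assoc, h]
  have h'' (k : Fin n) : act (a k) (twistedCommutator S (b k) ψ) i x
      = (rep (a k) x * (-Complex.I • ∑ c,
          spinLift (gammaE c) * matDeriv (rep (b k)) x (S.frame i c x))) *ᵥ ψ i x := by
    rw [← Matrix.mulVec_mulVec, ← twistedCommutator_apply S (b k) ψ i x hψ]
    rfl
  rw [h', Matrix.sum_mulVec, ← Finset.sum_congr rfl fun k _ => h'' k, freeOneForm,
    Finset.sum_apply, Finset.sum_apply]

end OneForms

/-! ### Coordinate vectors and orthonormal frames -/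

section Frames

variable {M : Type*} [TopologicalSpace M] [ChartedSpace E4 M]

theorem chart_mDifferentiable {φ : OpenPartialHomeomorph M E4}
    (hφ : φ ∈ IsManifold.maximalAtlas (𝓡 4) ∞ M) : φ.MDifferentiable (𝓡 4) (𝓡 4) := by
  constructor
  · exact (contMDiffOn_of_mem_maximalAtlas hφ).mdifferentiableOn (by simp)
  · exact (contMDiffOn_symm_of_mem_maximalAtlas hφ).mdifferentiableOn (by simp)

theorem SMFunction.contMDiff_fibre (f : SMFunction M) :
    ContMDiff (𝓡 4) 𝓘(ℝ, Fibre) ∞ f.fibre := by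
  have hm : ContMDiff (𝓡 4) 𝓘(ℝ, Fin 3 → Fin 3 → ℂ) ∞ (fun y i j => f.m i j y) :=
    contMDiff_pi_space.2 fun i => contMDiff_pi_space.2 fun j => (f.m i j).contMDiff
  exact f.c.contMDiff.prodMk_space (f.q.contMDiff.prodMk_space hm)

theorem contDiff_fibreMul : ContDiff ℝ ∞ (fun u : Fibre × Fibre => fibreMul u.1 u.2) := by
  unfold fibreMul
  refine ContDiff.prodMk (by fun_prop) (ContDiff.prodMk (by fun_prop) ?_)
  refine contDiff_pi.2 fun i => contDiff_pi.2 fun j => ?_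
  fun_prop

theorem isInvertible_mfderiv_chart {φ : OpenPartialHomeomorph M E4}
    (hφ : φ ∈ IsManifold.maximalAtlas (𝓡 4) ∞ M) {x : M} (hx : x ∈ φ.source) :
    (mfderiv (𝓡 4) (𝓡 4) φ x).IsInvertible :=
  ⟨(chart_mDifferentiable hφ).mfderiv hx, rfl⟩

/-- The differential of a chart, with values in the model space, gives the coordinate vectors and
the components of tangent vectors. -/
theorem exists_chart_equiv {φ : OpenPartialHomeomorph M E4}
    (hφ : φ ∈ IsManifold.maximalAtlas (𝓡 4) ∞ M) {x : M} (hx : x ∈ φ.source) :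
    ∃ e : TangentSpace (𝓡 4) x ≃L[ℝ] E4, (∀ v μ, coordComp φ μ x v = e v μ) ∧
      ∀ μ, coordVec φ μ x = e.symm (EuclideanSpace.single μ (1 : ℝ)) := by
  obtain ⟨e, he⟩ := isInvertible_mfderiv_chart hφ hx
  refine ⟨e, fun v μ => ?_, fun μ => ?_⟩
  · rw [coordComp, ← he]
    rfl
  · rw [coordVec, ← he, ContinuousLinearMap.inverse_equiv]
    rfl

/-- The coordinate expansion of a tangent vector. -/
theorem sum_coordComp_smul_coordVec {φ : OpenPartialHomeomorph M E4}
    (hφ : φ ∈ IsManifold.maximalAtlas (𝓡 4) ∞ M) {x : M} (hx : x ∈ φ.source)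
    (v : TangentSpace (𝓡 4) x) : ∑ μ, coordComp φ μ x v • coordVec φ μ x = v := by
  obtain ⟨e, hcomp, hvec⟩ := exists_chart_equiv hφ hx
  apply e.injective
  simp only [hcomp, hvec, map_sum, map_smul, ContinuousLinearEquiv.apply_symm_apply]
  ext ν
  simp [Finset.sum_apply, Pi.single_apply]

theorem linearIndependent_coordVec {φ : OpenPartialHomeomorph M E4}
    (hφ : φ ∈ IsManifold.maximalAtlas (𝓡 4) ∞ M) {x : M} (hx : x ∈ φ.source) :
    LinearIndependent ℝ (fun μ => coordVec φ μ x) := by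
  obtain ⟨e, -, hvec⟩ := exists_chart_equiv hφ hx
  have h := (EuclideanSpace.basisFun (Fin 4) ℝ).toBasis.linearIndependent
  have h' := h.map' (e.symm.toLinearEquiv : E4 →ₗ[ℝ] TangentSpace (𝓡 4) x) (LinearEquiv.ker _)
  have h'' : (fun μ => coordVec φ μ x)
      = e.symm.toLinearEquiv ∘ (EuclideanSpace.basisFun (Fin 4) ℝ).toBasis := by
    funext μ
    simp [hvec]
  rw [h'']
  exact h'

variable [IsManifold (𝓡 4) ∞ M]

theorem contMDiffOn_coordVec {φ : OpenPartialHomeomorph M E4}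
    (hφ : φ ∈ IsManifold.maximalAtlas (𝓡 4) ∞ M) (μ : Fin 4) :
    ContMDiffOn (𝓡 4) (𝓡 4).tangent ∞
      (fun x => (⟨x, coordVec φ μ x⟩ : TangentBundle (𝓡 4) M)) φ.source := by
  have : IsManifold (𝓡 4) 1 M := IsManifold.of_le (n := ∞) (by simp)
  intro x hx
  have hV : ContMDiffAt 𝓘(ℝ, E4) 𝓘(ℝ, E4).tangent ∞
      (fun y : E4 => (⟨y, EuclideanSpace.single μ (1 : ℝ)⟩ : TangentBundle 𝓘(ℝ, E4) E4)) (φ x) :=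
    contMDiffAt_vectorSpace_iff_contDiffAt.2 contDiffAt_const
  exact (ContMDiffAt.mpullback_vectorField_preimage hV (contMDiffAt_of_mem_maximalAtlas hφ hx)
    (isInvertible_mfderiv_chart hφ hx) (by simp)).contMDiffWithinAt

/-- The derivative of a smooth function along a smooth vector field is smooth. -/
theorem contMDiffOn_dirDeriv {F : Type*} [NormedAddCommGroup F] [NormedSpace ℝ F] {f : M → F}
    (hf : ContMDiff (𝓡 4) 𝓘(ℝ, F) ∞ f) {s : (x : M) → TangentSpace (𝓡 4) x} {U : Set M}
    (hs : ContMDiffOn (𝓡 4) (𝓡 4).tangent ∞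
      (fun x => (⟨x, s x⟩ : TangentBundle (𝓡 4) M)) U) :
    ContMDiffOn (𝓡 4) 𝓘(ℝ, F) ∞ (fun x => dirDeriv f x (s x)) U := by
  have : IsManifold (𝓡 4) 1 M := IsManifold.of_le (n := ∞) (by simp)
  have h1 := (hf.contMDiff_tangentMap (m := ∞) (by simp)).comp_contMDiffOn hs
  exact (contMDiff_snd_tangentBundle_modelSpace F 𝓘(ℝ, F)).comp_contMDiffOn h1

variable {n : ℕ}

theorem contMDiffOn_formFibre (a b : Fin n → TwistedAlgebra M)
    {s : (x : M) → TangentSpace (𝓡 4) x} {U : Set M}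
    (hs : ContMDiffOn (𝓡 4) (𝓡 4).tangent ∞
      (fun x => (⟨x, s x⟩ : TangentBundle (𝓡 4) M)) U) :
    ContMDiffOn (𝓡 4) 𝓘(ℝ, Fibre) ∞ (fun x => formFibre a b x (s x)) U := by
  simp only [formFibre_eq_sum]
  have h (k : Fin n) : ContMDiffOn (𝓡 4) 𝓘(ℝ, Fibre) ∞
      (fun x => fibreMul ((a k).2.fibre x) (dirDeriv (b k).1.fibre x (s x))) U :=
    contDiff_fibreMul.contMDiff.comp_contMDiffOn
      ((a k).2.contMDiff_fibre.contMDiffOn.prodMk_space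
        (contMDiffOn_dirDeriv (b k).1.contMDiff_fibre hs))
  exact contMDiffOn_finsetSum fun k _ => h k

theorem contMDiffOn_formFibre_linear {F : Type*} [NormedAddCommGroup F] [NormedSpace ℝ F]
    (L : Fibre × Fibre →ₗ[ℝ] F) (a b : Fin n → TwistedAlgebra M)
    {s : (x : M) → TangentSpace (𝓡 4) x} {U : Set M}
    (hs : ContMDiffOn (𝓡 4) (𝓡 4).tangent ∞
      (fun x => (⟨x, s x⟩ : TangentBundle (𝓡 4) M)) U) :
    ContMDiffOn (𝓡 4) 𝓘(ℝ, F) ∞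
      (fun x => L (formFibre a b x (s x), formFibre (rho ∘ a) (rho ∘ b) x (s x))) U :=
  L.toContinuousLinearMap.contMDiff.comp_contMDiffOn
    ((contMDiffOn_formFibre a b hs).prodMk_space (contMDiffOn_formFibre (rho ∘ a) (rho ∘ b) hs))

variable [RiemannianBundle (fun x : M => TangentSpace (𝓡 4) x)] {ι : Type*}

/-- The expansion of a tangent vector in the orthonormal frame of a patch. -/
theorem sum_inner_smul_frame (S : SpinStructure M ι) {i : ι} {x : M} (hx : x ∈ S.patch i)
    (v : TangentSpace (𝓡 4) x) : ∑ c, (inner ℝ (S.frame i c x) v : ℝ) • S.frame i c x = v := by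
  have ho : Orthonormal ℝ (fun c => S.frame i c x) :=
    orthonormal_iff_ite.2 fun c d => S.orthonormal_frame i x hx c d
  have hd : Module.finrank ℝ (TangentSpace (𝓡 4) x) = 4 :=
    (finrank_euclideanSpace_fin : Module.finrank ℝ E4 = 4)
  have : FiniteDimensional ℝ (TangentSpace (𝓡 4) x) :=
    inferInstanceAs (FiniteDimensional ℝ E4)
  have hs : ⊤ ≤ Submodule.span ℝ (Set.range fun c => S.frame i c x) := by
    rw [ho.linearIndependent.span_eq_top_of_card_eq_finrank (by rw [hd]; simp)]
  have h := (OrthonormalBasis.mk ho hs).sum_repr' v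
  simpa using h

theorem contMDiffOn_metricMat [IsContMDiffRiemannianBundle (𝓡 4) ∞ E4
    (fun x : M => TangentSpace (𝓡 4) x)] {φ : OpenPartialHomeomorph M E4}
    (hφ : φ ∈ IsManifold.maximalAtlas (𝓡 4) ∞ M) (μ ν : Fin 4) :
    ContMDiffOn (𝓡 4) 𝓘(ℝ, ℝ) ∞ (fun x => metricMat φ x μ ν) φ.source :=
  ContMDiffOn.inner_bundle (IB := 𝓡 4) (contMDiffOn_coordVec hφ μ) (contMDiffOn_coordVec hφ ν)

end Frames

/-! ### The Riemannian integral -/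

section Integral

open MeasureTheory Topology

variable {M : Type*} [TopologicalSpace M] [ChartedSpace E4 M]
  [RiemannianBundle (fun x : M => TangentSpace (𝓡 4) x)]

/-- The density in the chart at `p` of the Riemannian volume, localised by a partition of unity. -/
noncomputable def chartWeight (ρ : SmoothPartitionOfUnity M (𝓡 4) M) (p : M) (y : E4) : ℝ :=
  ρ p ((chartAt E4 p).symm y) * Real.sqrt (metricMat (chartAt E4 p) ((chartAt E4 p).symm y)).det

/-- The matrix of the metric is the Gram matrix of the linearly independent coordinate vectors. -/
theorem det_metricMat_pos {φ : OpenPartialHomeomorph M E4}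
    (hφ : φ ∈ IsManifold.maximalAtlas (𝓡 4) ∞ M) {x : M} (hx : x ∈ φ.source) :
    0 < (metricMat φ x).det :=
  (Matrix.posDef_gram_of_linearIndependent (linearIndependent_coordVec hφ hx)).det_pos

theorem chartWeight_nonneg (ρ : SmoothPartitionOfUnity M (𝓡 4) M) (p : M) (y : E4) :
    0 ≤ chartWeight ρ p y :=
  mul_nonneg (ρ.nonneg p _) (Real.sqrt_nonneg _)

theorem hasFiniteSupport_chart_integral [CompactSpace M] {F : Type*} [NormedAddCommGroup F]
    [NormedSpace ℝ F]
    (ρ : SmoothPartitionOfUnity M (𝓡 4) M) (f : M → F) :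
    Function.HasFiniteSupport fun p : M => ∫ y in (chartAt E4 p).target,
      chartWeight ρ p y • f ((chartAt E4 p).symm y) := by
  refine (ρ.locallyFinite.finite_nonempty_of_compact).subset fun p hp => ?_
  by_contra h
  refine hp ?_
  have h0 : ∀ x, ρ p x = 0 := fun x => by
    by_contra hx
    exact h ⟨x, hx⟩
  simp [chartWeight, h0]

variable [IsManifold (𝓡 4) ∞ M]

/-- The partition of unity in the definition of the integral. -/
theorem exists_riemannianIntegral_eq [T2Space M] [CompactSpace M] :
    ∃ ρ : SmoothPartitionOfUnity M (𝓡 4) M, ρ.IsSubordinate (fun p => (chartAt E4 p).source) ∧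
      ∀ f : M → ℂ, riemannianIntegral f = ∑ᶠ p : M, ∫ y in (chartAt E4 p).target,
        chartWeight ρ p y • f ((chartAt E4 p).symm y) :=
  ⟨_, (SmoothPartitionOfUnity.exists_isSubordinate_chartAt_source (𝓡 4) M).choose_spec,
    fun _ => rfl⟩

variable [IsContMDiffRiemannianBundle (𝓡 4) ∞ E4 (fun x : M => TangentSpace (𝓡 4) x)]

theorem continuousOn_chartWeight (ρ : SmoothPartitionOfUnity M (𝓡 4) M) (p : M) :
    ContinuousOn (chartWeight ρ p) (chartAt E4 p).target := by
  have hφ : chartAt E4 p ∈ IsManifold.maximalAtlas (𝓡 4) ∞ M :=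
    IsManifold.chart_mem_maximalAtlas p
  have hsymm := (chartAt E4 p).continuousOn_symm
  have hmaps : Set.MapsTo (chartAt E4 p).symm (chartAt E4 p).target (chartAt E4 p).source :=
    (chartAt E4 p).symm.mapsTo
  have h1 : ContinuousOn (metricMat (chartAt E4 p)) (chartAt E4 p).source :=
    continuousOn_pi.2 fun μ => continuousOn_pi.2 fun ν =>
      (contMDiffOn_metricMat hφ μ ν).continuousOn
  have h2 : Continuous (fun A : Matrix (Fin 4) (Fin 4) ℝ => Real.sqrt A.det) :=
    Real.continuous_sqrt.comp (Continuous.matrix_det continuous_id)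
  exact ((ρ p).contMDiff.continuous.comp_continuousOn hsymm).mul
    ((h2.comp_continuousOn h1).comp hsymm hmaps)

variable [CompactSpace M]

theorem integrableOn_chartWeight_smul {F : Type*} [NormedAddCommGroup F] [NormedSpace ℝ F]
    {ρ : SmoothPartitionOfUnity M (𝓡 4) M}
    (hρ : ρ.IsSubordinate fun p => (chartAt E4 p).source) {f : M → F} (hf : Continuous f)
    (p : M) :
    IntegrableOn (fun y => chartWeight ρ p y • f ((chartAt E4 p).symm y))
      (chartAt E4 p).target := by
  have hcont : ContinuousOn (fun y => chartWeight ρ p y • f ((chartAt E4 p).symm y))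
      (chartAt E4 p).target :=
    (continuousOn_chartWeight ρ p).smul
      (hf.comp_continuousOn (chartAt E4 p).continuousOn_symm)
  have hK : IsCompact ((chartAt E4 p) '' tsupport (ρ p)) :=
    (isClosed_tsupport _).isCompact.image_of_continuousOn
      ((chartAt E4 p).continuousOn.mono (hρ p))
  have hKsub : (chartAt E4 p) '' tsupport (ρ p) ⊆ (chartAt E4 p).target := by
    rintro _ ⟨x, hx, rfl⟩
    exact (chartAt E4 p).map_source (hρ p hx)
  refine ((hcont.mono hKsub).integrableOn_compact hK).of_forall_sdiff_eq_zero
    (chartAt E4 p).open_target.measurableSet ?_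
  rintro y ⟨hy, hy'⟩
  have h0 : ρ p ((chartAt E4 p).symm y) = 0 := by
    by_contra h
    exact hy' ⟨_, subset_tsupport _ h, (chartAt E4 p).right_inv hy⟩
  simp [chartWeight, h0]

variable [T2Space M]

theorem riemannianIntegral_sub {f g : M → ℂ} (hf : Continuous f) (hg : Continuous g) :
    riemannianIntegral (f - g) = riemannianIntegral f - riemannianIntegral g := by
  obtain ⟨ρ, hρ, hint⟩ := exists_riemannianIntegral_eq (M := M)
  rw [hint, hint, hint, ← finsum_sub_distrib (hasFiniteSupport_chart_integral _ f)
    (hasFiniteSupport_chart_integral _ g)]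
  refine finsum_congr fun p => ?_
  rw [← integral_sub (integrableOn_chartWeight_smul hρ hf p)
    (integrableOn_chartWeight_smul hρ hg p)]
  simp only [Pi.sub_apply, smul_sub]

/-- The Riemannian volume charges every open set, because the weights of the partition of unity add
up to one and the metric is nondegenerate. -/
theorem riemannianIntegral_ne_zero {f : M → ℂ} (hf : Continuous f) (hf0 : ∀ x, 0 ≤ (f x).re)
    {x₀ : M} (hx₀ : 0 < (f x₀).re) : riemannianIntegral f ≠ 0 := by
  have hr : Continuous fun x => (f x).re := Complex.continuous_re.comp hf
  obtain ⟨ρ, hρ, hint⟩ := exists_riemannianIntegral_eq (M := M)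
  have hpos : 0 < ∑ᶠ p : M, ∫ y in (chartAt E4 p).target,
      chartWeight ρ p y • (f ((chartAt E4 p).symm y)).re := by
    have hnonneg (p : M) (y : E4) : 0 ≤ chartWeight ρ p y • (f ((chartAt E4 p).symm y)).re :=
      mul_nonneg (chartWeight_nonneg ρ p y) (hf0 _)
    refine finsum_pos (fun p => integral_nonneg (hnonneg p)) ?_
      (hasFiniteSupport_chart_integral ρ fun x => (f x).re)
    -- a chart whose weight is positive at `x₀`: the integrand is positive near the image of `x₀`
    obtain ⟨p, hp⟩ := ρ.exists_pos_of_mem (Set.mem_univ x₀)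
    refine ⟨p, ?_⟩
    have hcont : ContinuousOn (fun y => chartWeight ρ p y • (f ((chartAt E4 p).symm y)).re)
        (chartAt E4 p).target :=
      (continuousOn_chartWeight ρ p).smul
        (hr.comp_continuousOn (chartAt E4 p).continuousOn_symm)
    rw [setIntegral_pos_iff_support_of_nonneg_ae (Filter.Eventually.of_forall (hnonneg p))
      (integrableOn_chartWeight_smul hρ hr p)]
    have hopen := hcont.isOpen_inter_preimage (chartAt E4 p).open_target isOpen_Ioi
      (t := Set.Ioi 0)
    have hx : x₀ ∈ (chartAt E4 p).source := hρ p (subset_tsupport _ hp.ne')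
    have hmem : chartAt E4 p x₀ ∈ (chartAt E4 p).target ∩
        (fun y => chartWeight ρ p y • (f ((chartAt E4 p).symm y)).re) ⁻¹' Set.Ioi 0 := by
      refine ⟨(chartAt E4 p).map_source hx, ?_⟩
      have hdet := det_metricMat_pos
        (IsManifold.chart_mem_maximalAtlas (I := 𝓡 4) (n := ∞) p) hx
      simp only [Set.mem_preimage, Set.mem_Ioi, chartWeight, (chartAt E4 p).left_inv hx,
        smul_eq_mul]
      exact mul_pos (mul_pos hp (Real.sqrt_pos.2 hdet)) hx₀
    exact (hopen.measure_pos volume ⟨_, hmem⟩).trans_le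
      (measure_mono fun y hy => ⟨ne_of_gt hy.2, hy.1⟩)
  have heq : (riemannianIntegral f).re = ∑ᶠ p : M, ∫ y in (chartAt E4 p).target,
      chartWeight ρ p y • (f ((chartAt E4 p).symm y)).re := by
    rw [hint]
    refine (Complex.reAddGroupHom.map_finsum (hasFiniteSupport_chart_integral ρ f)).trans ?_
    refine finsum_congr fun p => ?_
    refine (Complex.reCLM.integral_comp_comm (integrableOn_chartWeight_smul hρ hf p)).symm.trans ?_
    simp
  intro h
  rw [← heq, h] at hpos
  simp at hpos

end Integral

/-! ### Localised spinors and pointwise selfadjointness -/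

section Selfadjoint

open Topology

theorem star_mulVec_dotProduct_mulVec {m : Type*} [Fintype m] [DecidableEq m] {U : Matrix m m ℂ}
    (hU : Uᴴ * U = 1) (v w : m → ℂ) : star (U *ᵥ v) ⬝ᵥ (U *ᵥ w) = star v ⬝ᵥ w := by
  rw [Matrix.star_mulVec, Matrix.dotProduct_mulVec, Matrix.vecMul_vecMul, hU, Matrix.vecMul_one]

theorem spinLift_conjTranspose_mul_self {h : Matrix SpinIx SpinIx ℂ} (hh : h ∈ spin4) :
    (spinLift h)ᴴ * spinLift h = 1 := by
  rw [spinLift_conjTranspose, ← spinLift_mul, conjTranspose_mul_self_of_mem_spin4 hh, spinLift_one]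

/-- A function defined on an open set becomes globally continuous after multiplication by the
square of a continuous function supported there. -/
theorem continuous_sq_mul {X : Type*} [TopologicalSpace X] {f : X → ℝ} (hf : Continuous f)
    {h : X → ℂ} {U : Set X}
    (hU : IsOpen U) (hsupp : tsupport f ⊆ U) (hh : ContinuousOn h U) :
    Continuous fun x => (f x : ℂ) ^ 2 * h x := by
  refine continuous_of_tsupport fun x hx => ?_
  have hxf : x ∈ tsupport f := by
    refine closure_mono ?_ hx
    intro y hy
    contrapose! hy
    simp [Function.notMem_support.1 hy]
  exact ((Complex.continuous_ofReal.comp hf).pow 2).continuousAt.mul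
    (hh.continuousAt (hU.mem_nhds (hsupp hxf)))

variable {M : Type*} [TopologicalSpace M] [ChartedSpace E4 M] {n : ℕ}

theorem formComponent_sum (a b : Fin n → TwistedAlgebra M) (x : M) {κ : Type*} (s : Finset κ)
    (r : κ → ℝ) (v : κ → TangentSpace (𝓡 4) x) :
    formComponent a b x (∑ c ∈ s, r c • v c) = ∑ c ∈ s, (r c : ℂ) • formComponent a b x (v c) := by
  classical
  induction s using Finset.induction_on with
  | empty =>
    have h := formComponent_smul a b x 0 0
    simpa using h
  | insert c s hc ih =>
    rw [Finset.sum_insert hc, Finset.sum_insert hc, formComponent_add, formComponent_smul, ih]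

theorem IsEvenSpin.spinLift_mul_formComponent {T : Matrix SpinIx SpinIx ℂ} (hT : IsEvenSpin T)
    (a b : Fin n → TwistedAlgebra M) (x : M) (v : TangentSpace (𝓡 4) x) :
    spinLift T * formComponent a b x v = formComponent a b x v * spinLift T := by
  rw [formComponent_eq]
  exact hT.spinLift_mul_fibreRep _ _

variable [IsManifold (𝓡 4) ∞ M] [RiemannianBundle (fun x : M => TangentSpace (𝓡 4) x)]
  {ι : Type*}

/-- On an overlap, the matrix of a free one-form can be computed with the components in the frame
of the other patch. -/
theorem oneFormMat_eq_cliffE (S : SpinStructure M ι) (a b : Fin n → TwistedAlgebra M) {i j : ι}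
    {x : M} (hj : x ∈ S.patch j) :
    oneFormMat S a b i x = -Complex.I • ∑ d,
      spinLift (cliffE fun c => inner ℝ (S.frame i c x) (S.frame j d x))
        * formComponent a b x (S.frame j d x) := by
  have h (c : Fin 4) : formComponent a b x (S.frame i c x)
      = ∑ d, ((inner ℝ (S.frame i c x) (S.frame j d x) : ℝ) : ℂ)
        • formComponent a b x (S.frame j d x) := by
    conv_lhs => rw [← sum_inner_smul_frame S hj (S.frame i c x)]
    rw [formComponent_sum]
    simp only [real_inner_comm]
  simp only [oneFormMat, h, cliffE, spinLift_sum, spinLift_smul, Finset.mul_sum, Finset.sum_mul,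
    Matrix.smul_mul, Matrix.mul_smul]
  rw [Finset.sum_comm]

/-- The matrices of a free one-form in two patches are conjugate under the transition function. -/
theorem oneFormMat_mul_trans (S : SpinStructure M ι) (a b : Fin n → TwistedAlgebra M) {i j : ι}
    {x : M} (hx : x ∈ S.patch i ∩ S.patch j) :
    oneFormMat S a b i x * spinLift (S.trans i j x)
      = spinLift (S.trans i j x) * oneFormMat S a b j x := by
  rw [oneFormMat_eq_cliffE S a b (i := i) hx.2, oneFormMat_eq_cliffE S a b (i := j) hx.2]
  have heven := isEvenSpin_of_mem_spin4 (S.trans_mem i j x hx)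
  simp only [Matrix.smul_mul, Matrix.mul_smul, Finset.sum_mul, Finset.mul_sum]
  congr 1
  refine Finset.sum_congr rfl fun d _ => ?_
  rw [mul_assoc, ← heven.spinLift_mul_formComponent, ← mul_assoc, ← spinLift_mul,
    S.lift_frame i j x hx, spinLift_mul, mul_assoc]

theorem continuousOn_oneFormMat (S : SpinStructure M ι) (a b : Fin n → TwistedAlgebra M) (i : ι) :
    ContinuousOn (oneFormMat S a b i) (S.patch i) := by
  refine continuousOn_pi.2 fun p => continuousOn_pi.2 fun q => ?_
  have h (c : Fin 4) : ContinuousOn (fun x => (spinLift (gammaE c)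
      * formComponent a b x (S.frame i c x)) p q) (S.patch i) := by
    simp only [formComponent_eq]
    exact (contMDiffOn_formFibre_linear (Matrix.entryLinearMap ℝ ℂ p q
      ∘ₗ LinearMap.mulLeft ℝ (spinLift (gammaE c)) ∘ₗ fibreRepLin) a b
      (S.smooth_frame i c)).continuousOn
  have h' : ContinuousOn (fun x => -Complex.I * ∑ c, (spinLift (gammaE c)
      * formComponent a b x (S.frame i c x)) p q) (S.patch i) :=
    continuousOn_const.mul (continuousOn_finsetSum _ fun c _ => h c)
  refine h'.congr fun x _ => ?_
  simp only [oneFormMat, Matrix.smul_apply, Matrix.sum_apply, smul_eq_mul]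

/-- The spinor field which in a given patch is `f` times a constant vector. -/
noncomputable def localSpinor (S : SpinStructure M ι) (i : ι) (f : M → ℝ) (v : Full → ℂ) :
    LocalSpinor M ι := fun j y => (f y : ℂ) • (spinLift (S.trans j i y) *ᵥ v)

theorem isSmoothSpinor_localSpinor (S : SpinStructure M ι) {i : ι} {f : M → ℝ}
    (hf : ContMDiff (𝓡 4) 𝓘(ℝ, ℝ) ∞ f) (hsupp : tsupport f ⊆ S.patch i) (v : Full → ℂ) :
    IsSmoothSpinor S (localSpinor S i f v) := by
  constructor
  · intro j p x hx
    by_cases hxf : x ∈ tsupport f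
    · have hxi := hsupp hxf
      have htrans : ContMDiffOn (𝓡 4) 𝓘(ℝ, SpinIx → SpinIx → ℂ) ∞ (fun y r s => S.trans j i y r s)
          (S.patch j ∩ S.patch i) :=
        contMDiffOn_pi_space.2 fun r => contMDiffOn_pi_space.2 fun s => S.smooth_trans j i r s
      let L : (SpinIx → SpinIx → ℂ) →ₗ[ℝ] ℂ :=
        { toFun := fun T => (spinLift (Matrix.of T) *ᵥ v) p
          map_add' := fun T T' => by
            have h := spinLift_add (Matrix.of T) (Matrix.of T')
            have h' : Matrix.of (T + T') = Matrix.of T + Matrix.of T' := rfl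
            rw [h', h, Matrix.add_mulVec, Pi.add_apply]
          map_smul' := fun r T => by
            have h := spinLift_smul (r : ℂ) (Matrix.of T)
            have h' : Matrix.of (r • T) = (r : ℂ) • Matrix.of T := by
              ext
              simp
            rw [h', h, Matrix.smul_mulVec, Pi.smul_apply]
            simp }
      have hL := L.toContinuousLinearMap.contMDiff.comp_contMDiffOn htrans
      have hof : ContMDiff (𝓡 4) 𝓘(ℝ, ℂ) ∞ (fun y => (f y : ℂ)) :=
        Complex.ofRealCLM.contMDiff.comp hf
      have h := (contDiff_mul (𝕜 := ℝ) (n := ∞) (𝔸 := ℂ)).contMDiff.comp_contMDiffOn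
        (hof.contMDiffOn.prodMk_space hL)
      exact (h.contMDiffAt (((S.isOpen_patch j).inter (S.isOpen_patch i)).mem_nhds
        ⟨hx, hxi⟩)).contMDiffWithinAt
    · have h0 : (fun y => localSpinor S i f v j y p) =ᶠ[𝓝 x] fun _ => 0 := by
        filter_upwards [notMem_tsupport_iff_eventuallyEq.1 hxf] with y hy
        simp [localSpinor, hy]
      exact (contMDiffAt_const.congr_of_eventuallyEq h0).contMDiffWithinAt
  · intro j k x hx
    by_cases hxf : f x = 0
    · simp [localSpinor, hxf]
    · have hxi : x ∈ S.patch i := hsupp (subset_tsupport f hxf)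
      rw [localSpinor, localSpinor, ← S.cocycle j k i x ⟨hx, hxi⟩, spinLift_mul,
        Matrix.mulVec_smul, Matrix.mulVec_mulVec]

theorem IsSmoothSpinor.mdifferentiableAt {S : SpinStructure M ι} {ψ : LocalSpinor M ι}
    (hψ : IsSmoothSpinor S ψ) {i : ι} {x : M} (hx : x ∈ S.patch i) (p : Full) :
    MDifferentiableAt (𝓡 4) 𝓘(ℝ, ℂ) (fun y => ψ i y p) x :=
  ((hψ.smooth i p).contMDiffAt ((S.isOpen_patch i).mem_nhds hx)).mdifferentiableAt (by simp)

theorem freeOneForm_localSpinor (S : SpinStructure M ι) (a b : Fin n → TwistedAlgebra M) {i j : ι}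
    {f : M → ℝ} (hf : ContMDiff (𝓡 4) 𝓘(ℝ, ℝ) ∞ f) (hsupp : tsupport f ⊆ S.patch i)
    (v : Full → ℂ) {x : M} (hx : x ∈ S.patch j ∩ S.patch i) :
    freeOneForm S a b (localSpinor S i f v) j x
      = (f x : ℂ) • (spinLift (S.trans j i x) *ᵥ (oneFormMat S a b i x *ᵥ v)) := by
  rw [freeOneForm_apply S a b _ j x
    fun p => (isSmoothSpinor_localSpinor S hf hsupp v).mdifferentiableAt hx.1 p,
    localSpinor, Matrix.mulVec_smul, Matrix.mulVec_mulVec, oneFormMat_mul_trans S a b hx,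
    Matrix.mulVec_mulVec]

theorem fibreInner_freeOneForm_left (S : SpinStructure M ι) (a b : Fin n → TwistedAlgebra M)
    {i : ι} {f : M → ℝ} (hf : ContMDiff (𝓡 4) 𝓘(ℝ, ℝ) ∞ f) (hsupp : tsupport f ⊆ S.patch i)
    (v w : Full → ℂ) (x : M) :
    fibreInner S (freeOneForm S a b (localSpinor S i f v)) (localSpinor S i f w) x
      = (f x : ℂ) ^ 2 * (star (oneFormMat S a b i x *ᵥ v) ⬝ᵥ w) := by
  have hj := (S.cover x).choose_spec
  rw [fibreInner]
  by_cases hxf : f x = 0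
  · simp [localSpinor, hxf]
  · have hxi : x ∈ S.patch i := hsupp (subset_tsupport f hxf)
    rw [freeOneForm_localSpinor S a b hf hsupp v ⟨hj, hxi⟩, localSpinor, star_smul,
      smul_dotProduct, dotProduct_smul, star_mulVec_dotProduct_mulVec
        (spinLift_conjTranspose_mul_self (S.trans_mem _ i x ⟨hj, hxi⟩))]
    simp only [smul_eq_mul, Complex.star_def, Complex.conj_ofReal]
    ring

theorem fibreInner_freeOneForm_right (S : SpinStructure M ι) (a b : Fin n → TwistedAlgebra M)
    {i : ι} {f : M → ℝ} (hf : ContMDiff (𝓡 4) 𝓘(ℝ, ℝ) ∞ f) (hsupp : tsupport f ⊆ S.patch i)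
    (v w : Full → ℂ) (x : M) :
    fibreInner S (localSpinor S i f v) (freeOneForm S a b (localSpinor S i f w)) x
      = (f x : ℂ) ^ 2 * (star v ⬝ᵥ (oneFormMat S a b i x *ᵥ w)) := by
  have hj := (S.cover x).choose_spec
  rw [fibreInner]
  by_cases hxf : f x = 0
  · simp [localSpinor, hxf]
  · have hxi : x ∈ S.patch i := hsupp (subset_tsupport f hxf)
    rw [freeOneForm_localSpinor S a b hf hsupp w ⟨hj, hxi⟩, localSpinor, star_smul,
      smul_dotProduct, dotProduct_smul, star_mulVec_dotProduct_mulVec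
        (spinLift_conjTranspose_mul_self (S.trans_mem _ i x ⟨hj, hxi⟩))]
    simp only [smul_eq_mul, Complex.star_def, Complex.conj_ofReal]
    ring

variable [IsContMDiffRiemannianBundle (𝓡 4) ∞ E4 (fun x : M => TangentSpace (𝓡 4) x)]
  [T2Space M] [CompactSpace M]

/-- A selfadjoint free one-form acts by a selfadjoint matrix on each fibre. If that failed at a
point, for a vector `w`, the integrated identity would fail for the spinors obtained from `w` and
`v = (T† - T) w` with a bump function: the difference of the two integrands is
`f² ⟨v, (T† - T) w⟩`, whose real part is positive near that point. -/
theorem isHermitian_oneFormMat {S : SpinStructure M ι} {a b : Fin n → TwistedAlgebra M}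
    (hself : IsSelfadjointOp S (freeOneForm S a b)) {i : ι} {x₀ : M} (hx₀ : x₀ ∈ S.patch i) :
    (oneFormMat S a b i x₀).IsHermitian := by
  set T := oneFormMat S a b i with hT
  suffices h : ∀ w, ((T x₀)ᴴ - T x₀) *ᵥ w = 0 by
    refine sub_eq_zero.1 (Matrix.ext_of_mulVec_single fun p => ?_)
    rw [h, Matrix.zero_mulVec]
  intro w
  by_contra hw
  set v := ((T x₀)ᴴ - T x₀) *ᵥ w with hv
  have hcT : ContinuousOn T (S.patch i) := continuousOn_oneFormMat S a b i
  have hc1 : ContinuousOn (fun x => star (T x *ᵥ v) ⬝ᵥ w) (S.patch i) := by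
    have h : Continuous fun A : Matrix Full Full ℂ => star (A *ᵥ v) ⬝ᵥ w := by fun_prop
    exact h.comp_continuousOn hcT
  have hc2 : ContinuousOn (fun x => star v ⬝ᵥ (T x *ᵥ w)) (S.patch i) := by
    have h : Continuous fun A : Matrix Full Full ℂ => star v ⬝ᵥ (A *ᵥ w) := by fun_prop
    exact h.comp_continuousOn hcT
  have hc := Complex.continuous_re.comp_continuousOn (hc1.sub hc2)
  have hx₀pos : 0 < (star (T x₀ *ᵥ v) ⬝ᵥ w - star v ⬝ᵥ (T x₀ *ᵥ w)).re := by
    have h : star (T x₀ *ᵥ v) ⬝ᵥ w - star v ⬝ᵥ (T x₀ *ᵥ w) = star v ⬝ᵥ v := by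
      rw [Matrix.star_mulVec, ← Matrix.dotProduct_mulVec, ← dotProduct_sub, ← Matrix.sub_mulVec]
    rw [h]
    have h' : star v ⬝ᵥ v = ((∑ p, ‖v p‖ ^ 2 : ℝ) : ℂ) := by
      simp [dotProduct, Complex.conj_mul']
    rw [h', Complex.ofReal_re]
    obtain ⟨p, hp⟩ := Function.ne_iff.1 hw
    exact Finset.sum_pos' (fun _ _ => by positivity)
      ⟨p, Finset.mem_univ p, by have := norm_pos_iff.2 hp; positivity⟩
  -- the bump function is supported where the real part of the integrand is positive
  have hopen := hc.isOpen_inter_preimage (S.isOpen_patch i) (isOpen_Ioi (a := (0 : ℝ)))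
  obtain ⟨f, -, hf⟩ := (SmoothBumpFunction.nhds_basis_tsupport (I := 𝓡 4) x₀).mem_iff.1
    (hopen.mem_nhds ⟨hx₀, hx₀pos⟩)
  have hsupp : tsupport f ⊆ S.patch i := fun x hx => (hf hx).1
  have hfs : ContMDiff (𝓡 4) 𝓘(ℝ, ℝ) ∞ f := f.contMDiff
  have hint := hself _ _ (isSmoothSpinor_localSpinor S hfs hsupp v)
    (isSmoothSpinor_localSpinor S hfs hsupp w)
  rw [l2Inner, l2Inner, funext (fibreInner_freeOneForm_left S a b hfs hsupp v w),
    funext (fibreInner_freeOneForm_right S a b hfs hsupp v w)] at hint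
  have hF := continuous_sq_mul f.continuous (S.isOpen_patch i) hsupp hc1
  have hG := continuous_sq_mul f.continuous (S.isOpen_patch i) hsupp hc2
  have hdiff (x : M) : (((fun x => (f x : ℂ) ^ 2 * (star (T x *ᵥ v) ⬝ᵥ w))
      - fun x => (f x : ℂ) ^ 2 * (star v ⬝ᵥ (T x *ᵥ w))) x).re
      = f x ^ 2 * (star (T x *ᵥ v) ⬝ᵥ w - star v ⬝ᵥ (T x *ᵥ w)).re := by
    rw [Pi.sub_apply, ← mul_sub, ← Complex.ofReal_pow, Complex.re_ofReal_mul]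
  refine riemannianIntegral_ne_zero (hF.sub hG) (x₀ := x₀) (fun x => ?_) ?_
    ((riemannianIntegral_sub hF hG).trans (sub_eq_zero.2 hint))
  · rw [hdiff]
    by_cases hx : x ∈ tsupport f
    · exact mul_nonneg (sq_nonneg _) (hf hx).2.le
    · rw [image_eq_zero_of_notMem_tsupport hx]
      simp
  · rw [hdiff, f.eq_one]
    simpa using hx₀pos

end Selfadjoint

/-! ### The relations between the two chiralities -/

section Relations

theorem sigma_linearIndependent {z : Fin 4 → ℂ} (h : ∀ s t, ∑ c, sigma c s t * z c = 0) :
    ∀ c, z c = 0 := by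
  have h00 := h 0 0
  have h01 := h 0 1
  have h10 := h 1 0
  have h11 := h 1 1
  simp [sigma, pauli, Fin.sum_univ_four] at h00 h01 h10 h11
  have hI := Complex.I_ne_zero
  intro c
  fin_cases c
  · change z 0 = 0
    linear_combination (1 / 2) * h00 + (1 / 2) * h11
  · exact (mul_eq_zero.1 (show Complex.I * z 1 = 0 by
      linear_combination (-1 / 2) * h01 + (-1 / 2) * h10)).resolve_left hI
  · change z 2 = 0
    linear_combination (1 / 2) * h10 - (1 / 2) * h01
  · exact (mul_eq_zero.1 (show Complex.I * z 3 = 0 by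
      linear_combination (-1 / 2) * h00 + (1 / 2) * h11)).resolve_left hI

theorem sigmaTilde_linearIndependent {z : Fin 4 → ℂ}
    (h : ∀ s t, ∑ c, sigmaTilde c s t * z c = 0) : ∀ c, z c = 0 := by
  have h00 := h 0 0
  have h01 := h 0 1
  have h10 := h 1 0
  have h11 := h 1 1
  simp [sigmaTilde, pauli, Fin.sum_univ_four] at h00 h01 h10 h11
  have hI := Complex.I_ne_zero
  intro c
  fin_cases c
  · change z 0 = 0
    linear_combination (1 / 2) * h00 + (1 / 2) * h11
  · exact (mul_eq_zero.1 (show Complex.I * z 1 = 0 by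
      linear_combination (1 / 2) * h01 + (1 / 2) * h10)).resolve_left hI
  · change z 2 = 0
    linear_combination (1 / 2) * h01 - (1 / 2) * h10
  · exact (mul_eq_zero.1 (show Complex.I * z 3 = 0 by
      linear_combination (1 / 2) * h00 - (1 / 2) * h11)).resolve_left hI

theorem gammaE_kronecker_mul_chiral (c : Fin 4) (A B : Matrix Internal Internal ℂ) :
    gammaE c ⊗ₖ (1 : Matrix Internal Internal ℂ) * chiral A B
      = (Matrix.fromBlocks 0 0 (sigmaTilde c) 0 : Matrix SpinIx SpinIx ℂ) ⊗ₖ A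
        + (Matrix.fromBlocks 0 (sigma c) 0 0 : Matrix SpinIx SpinIx ℂ) ⊗ₖ B := by
  simp [chiral, gammaE, mul_add, ← Matrix.mul_kronecker_mul, Matrix.fromBlocks_multiply]

theorem sum_gammaE_kronecker_mul_chiral_eq_zero {A B : Fin 4 → Matrix Internal Internal ℂ}
    (h : ∑ c, gammaE c ⊗ₖ (1 : Matrix Internal Internal ℂ) * chiral (A c) (B c) = 0) :
    ∀ c, A c = 0 ∧ B c = 0 := by
  simp only [gammaE_kronecker_mul_chiral] at h
  have hA (p q : Internal) : ∀ c, A c p q = 0 := by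
    refine sigmaTilde_linearIndependent fun s t => ?_
    have h' := congrFun (congrFun h (Sum.inr s, p)) (Sum.inl t, q)
    simpa [Matrix.sum_apply, Matrix.kroneckerMap_apply] using h'
  have hB (p q : Internal) : ∀ c, B c p q = 0 := by
    refine sigma_linearIndependent fun s t => ?_
    have h' := congrFun (congrFun h (Sum.inl s, p)) (Sum.inr t, q)
    simpa [Matrix.sum_apply, Matrix.kroneckerMap_apply] using h'
  exact fun c => ⟨Matrix.ext fun p q => hA p q c, Matrix.ext fun p q => hB p q c⟩

/-- The Dirac matrices are linearly independent over the matrices acting on the internal and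
chirality indices. -/
theorem sum_spinLift_gammaE_mul_blockMat_eq_zero {A B C D : Fin 4 → Matrix Internal Internal ℂ}
    (h : ∑ c, spinLift (gammaE c) * blockMat (A c) (B c) (C c) (D c) = 0) (c : Fin 4) :
    A c = 0 ∧ C c = 0 := by
  have h1 : (∑ c, spinLift (gammaE c) * blockMat (A c) (B c) (C c) (D c)).toBlocks₁₁
      = ∑ c, gammaE c ⊗ₖ (1 : Matrix Internal Internal ℂ) * chiral (A c) (B c) := by
    ext p q
    simp [Matrix.toBlocks₁₁, Matrix.sum_apply, spinLift, blockMat, Matrix.fromBlocks_multiply]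
  have h2 : (∑ c, spinLift (gammaE c) * blockMat (A c) (B c) (C c) (D c)).toBlocks₂₂
      = ∑ c, gammaE c ⊗ₖ (1 : Matrix Internal Internal ℂ) * chiral (C c) (D c) := by
    ext p q
    simp [Matrix.toBlocks₂₂, Matrix.sum_apply, spinLift, blockMat, Matrix.fromBlocks_multiply]
  rw [h] at h1 h2
  exact ⟨(sum_gammaE_kronecker_mul_chiral_eq_zero h1.symm c).1,
    (sum_gammaE_kronecker_mul_chiral_eq_zero h2.symm c).1⟩

/-- The adjoint in `ℂ ⊕ ℍ ⊕ M₃(ℂ)`. -/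
noncomputable def fibreStar (u : Fibre) : Fibre :=
  (star u.1, star u.2.1, fun i j => star (u.2.2 j i))

theorem fibreStar_add (u w : Fibre) : fibreStar (u + w) = fibreStar u + fibreStar w := by
  refine Prod.ext (star_add _ _) (Prod.ext (star_add _ _) ?_)
  funext i j
  exact star_add _ _

theorem fibreStar_smul (r : ℝ) (u : Fibre) : fibreStar (r • u) = r • fibreStar u := by
  refine Prod.ext (by simp [fibreStar]) (Prod.ext (by simp [fibreStar]) ?_)
  funext i j
  simp [fibreStar]

/-- The representation of `ℂ ⊕ ℍ ⊕ M₃(ℂ)` being faithful, a relation between blocks is a relation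
between fields. -/
theorem eq_neg_fibreStar {u u' : Fibre} (hQ : particleBlock u u' + (particleBlock u' u)ᴴ = 0)
    (hM : antiparticleBlock u u' + (antiparticleBlock u' u)ᴴ = 0) : u' = -fibreStar u := by
  have h1 : flavourRep (u.1 + star u'.1) (u'.2.1 + star u.2.1) = flavourRep 0 0 := by
    rw [flavourRep_add, ← flavourRep_star]
    ext α β
    have h := congrFun (congrFun hQ (Sum.inl (), α)) (Sum.inl (), β)
    have h0 : flavourRep 0 0 = 0 := by simpa using flavourRep_smul 0 0 0
    rw [h0]
    simpa [particleBlock, particleRep, Matrix.kroneckerMap_apply] using h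
  have h2 : Matrix.of u.2.2 + (Matrix.of u'.2.2)ᴴ = 0 := by
    ext i j
    have h := congrFun (congrFun hM (Sum.inr i, Sum.inl 0)) (Sum.inr j, Sum.inl 0)
    simpa [antiparticleBlock, colourRep, dotted, undotted, Matrix.kroneckerMap_apply] using h
  obtain ⟨hc, hq⟩ := flavourRep_inj h1
  refine Prod.ext ?_ (Prod.ext (eq_neg_of_add_eq_zero_left hq) ?_)
  · have h := congrArg star (eq_neg_of_add_eq_zero_right hc)
    simpa [fibreStar] using h
  · funext i j
    have h := congrFun (congrFun h2 j) i
    have h' := congrArg star (eq_neg_of_add_eq_zero_right h)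
    simpa [fibreStar] using h'

variable {M : Type*} [TopologicalSpace M] [ChartedSpace E4 M] {n : ℕ}

/-- The right- and left-handed parts of a free one-form, as a linear map on tangent vectors. -/
noncomputable def formPair (a b : Fin n → TwistedAlgebra M) (x : M) :
    TangentSpace (𝓡 4) x →ₗ[ℝ] Fibre × Fibre where
  toFun v := (formFibre a b x v, formFibre (rho ∘ a) (rho ∘ b) x v)
  map_add' u v := by rw [formFibre_add, formFibre_add]; rfl
  map_smul' r v := by rw [formFibre_smul, formFibre_smul]; rfl

variable [IsManifold (𝓡 4) ∞ M] [RiemannianBundle (fun x : M => TangentSpace (𝓡 4) x)]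
  {ι : Type*}

theorem formFibre_frame_of_isHermitian {S : SpinStructure M ι} {a b : Fin n → TwistedAlgebra M}
    {i : ι} {x : M} (h : (oneFormMat S a b i x).IsHermitian) (c : Fin 4) :
    formFibre (rho ∘ a) (rho ∘ b) x (S.frame i c x)
      = -fibreStar (formFibre a b x (S.frame i c x)) := by
  set r := fun c => formFibre a b x (S.frame i c x)
  set l := fun c => formFibre (rho ∘ a) (rho ∘ b) x (S.frame i c x)
  have hterm (c : Fin 4) : (spinLift (gammaE c) * formComponent a b x (S.frame i c x))ᴴ
      = spinLift (gammaE c) * blockMat (particleBlock (l c) (r c))ᴴ (particleBlock (r c) (l c))ᴴ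
          (antiparticleBlock (l c) (r c))ᴴ (antiparticleBlock (r c) (l c))ᴴ := by
    rw [formComponent_eq, fibreRep, Matrix.conjTranspose_mul, blockMat_conjTranspose,
      spinLift_conjTranspose, gammaE_conjTranspose, (isOddSpin_gammaE c).spinLift_mul_blockMat]
  have hT : (oneFormMat S a b i x)ᴴ = Complex.I • ∑ c, spinLift (gammaE c)
      * blockMat (particleBlock (l c) (r c))ᴴ (particleBlock (r c) (l c))ᴴ
          (antiparticleBlock (l c) (r c))ᴴ (antiparticleBlock (r c) (l c))ᴴ := by
    rw [oneFormMat, Matrix.conjTranspose_smul, Matrix.conjTranspose_sum,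
      Finset.sum_congr rfl fun c _ => hterm c]
    simp
  have hsum : ∑ c, spinLift (gammaE c) * blockMat
      (particleBlock (r c) (l c) + (particleBlock (l c) (r c))ᴴ)
      (particleBlock (l c) (r c) + (particleBlock (r c) (l c))ᴴ)
      (antiparticleBlock (r c) (l c) + (antiparticleBlock (l c) (r c))ᴴ)
      (antiparticleBlock (l c) (r c) + (antiparticleBlock (r c) (l c))ᴴ) = 0 := by
    have h' : Complex.I • ∑ c, spinLift (gammaE c) * blockMat
        (particleBlock (r c) (l c) + (particleBlock (l c) (r c))ᴴ)
        (particleBlock (l c) (r c) + (particleBlock (r c) (l c))ᴴ)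
        (antiparticleBlock (r c) (l c) + (antiparticleBlock (l c) (r c))ᴴ)
        (antiparticleBlock (l c) (r c) + (antiparticleBlock (r c) (l c))ᴴ)
        = (oneFormMat S a b i x)ᴴ - oneFormMat S a b i x := by
      rw [hT, oneFormMat]
      simp only [formComponent_eq, fibreRep, blockMat_add, mul_add, Finset.sum_add_distrib,
        smul_add, neg_smul, sub_neg_eq_add]
      exact add_comm _ _
    rw [h.eq, sub_self] at h'
    exact (smul_eq_zero.1 h').resolve_left Complex.I_ne_zero
  obtain ⟨hQ, hM⟩ := sum_spinLift_gammaE_mul_blockMat_eq_zero hsum c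
  exact eq_neg_fibreStar hQ hM

/-- Selfadjointness determines the left-handed fields by the right-handed ones. -/
theorem formFibre_rho_eq_neg_fibreStar {S : SpinStructure M ι} {a b : Fin n → TwistedAlgebra M}
    (h : ∀ i, ∀ x ∈ S.patch i, (oneFormMat S a b i x).IsHermitian) (x : M)
    (v : TangentSpace (𝓡 4) x) :
    formFibre (rho ∘ a) (rho ∘ b) x v = -fibreStar (formFibre a b x v) := by
  obtain ⟨i, hx⟩ := S.cover x
  rw [← sum_inner_smul_frame S hx v]
  refine Finset.sum_induction _ (fun u => formFibre (rho ∘ a) (rho ∘ b) x u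
    = -fibreStar (formFibre a b x u)) (fun u w hu hw => ?_) ?_ fun c _ => ?_
  · rw [formFibre_add, formFibre_add, hu, hw, fibreStar_add, neg_add]
  · have h1 := formFibre_smul (rho ∘ a) (rho ∘ b) x 0 0
    have h2 := formFibre_smul a b x 0 0
    have h3 := fibreStar_smul 0 0
    simp only [zero_smul] at h1 h2 h3
    rw [h1, h2, h3, neg_zero]
  · rw [formFibre_smul, formFibre_smul, fibreStar_smul,
      formFibre_frame_of_isHermitian (h i x hx) c, smul_neg]

end Relations

/-! ### The trace condition -/

/-- The particle blocks have a real trace: `c` and `c̄` occur equally often and quaternions have a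
real trace. The imaginary part of the trace therefore only sees antiparticles. -/
theorem trace_particleBlock (u u' : Fibre) :
    (particleBlock u u').trace = ((8 * (u.1.re + u'.2.1.re) : ℝ) : ℂ) := by
  simp only [particleBlock, particleRep, Matrix.trace_kronecker]
  apply Complex.ext
  · simp [Matrix.trace, flavourRep, quatMat, Fintype.sum_sum_type, Fin.sum_univ_two]
    ring
  · simp [Matrix.trace, flavourRep, quatMat, Fintype.sum_sum_type, Fin.sum_univ_two]

theorem trace_antiparticleBlock (u u' : Fibre) :
    (antiparticleBlock u u').trace
      = 2 * (u.1 + (Matrix.of u.2.2).trace) + 2 * (u'.1 + (Matrix.of u'.2.2).trace) := by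
  simp only [antiparticleBlock, Matrix.trace_add, Matrix.trace_kronecker]
  simp [Matrix.trace, colourRep, dotted, undotted, Fintype.sum_sum_type]
  ring

/-- The content of unimodularity for a selfadjoint one-form: the imaginary part of the trace of the
`M₃(ℂ)`-component is opposite to that of the `ℂ`-component. -/
theorem im_trace_of_trace_fibreRep {u : Fibre} (h : (fibreRep u (-fibreStar u)).trace = 0) :
    (Matrix.of u.2.2).trace.im = -u.1.im := by
  have h' := congrArg Complex.im h
  rw [fibreRep, trace_blockMat, trace_particleBlock, trace_particleBlock,
    trace_antiparticleBlock, trace_antiparticleBlock] at h'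
  simp [fibreStar, Matrix.trace, Fin.sum_univ_three] at h' ⊢
  linarith

/-! ### The twisted fluctuation -/

section Fluctuation

/-- The particle block of `A + J A J⁻¹` in one chirality. -/
noncomputable def halfMat (u u' : Fibre) : Matrix Internal Internal ℂ :=
  particleBlock u u' + conjMat (antiparticleBlock u u')

theorem conjMat_smul {m n : Type*} (r : ℂ) (A : Matrix m n ℂ) :
    conjMat (r • A) = star r • conjMat A := by
  ext i j
  simp [conjMat]

theorem conjMat_conjMat {m n : Type*} (A : Matrix m n ℂ) : conjMat (conjMat A) = A := by
  ext i j
  simp [conjMat]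

theorem conjMat_mul {l m n : Type*} [Fintype m] (A : Matrix l m ℂ) (B : Matrix m n ℂ) :
    conjMat (A * B) = conjMat A * conjMat B := by
  ext i j
  simp [conjMat, Matrix.mul_apply]

theorem conjMat_sum {m n κ : Type*} (s : Finset κ) (A : κ → Matrix m n ℂ) :
    conjMat (∑ k ∈ s, A k) = ∑ k ∈ s, conjMat (A k) := by
  ext i j
  simp [conjMat, Matrix.sum_apply]

theorem halfMat_add (u u' w w' : Fibre) :
    halfMat (u + w) (u' + w') = halfMat u u' + halfMat w w' := by
  simp only [halfMat, particleBlock_add, antiparticleBlock_add, conjMat_add]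
  abel

theorem halfMat_smul (r : ℝ) (u u' : Fibre) :
    halfMat (r • u) (r • u') = (r : ℂ) • halfMat u u' := by
  simp only [halfMat, particleBlock_smul, antiparticleBlock_smul, conjMat_smul, smul_add,
    Complex.star_def, Complex.conj_ofReal]

/-- `halfMat` as a real-linear map: the right-handed block of `A + J A J⁻¹`. -/
noncomputable def halfLin : Fibre × Fibre →ₗ[ℝ] Matrix Internal Internal ℂ where
  toFun u := halfMat u.1 u.2
  map_add' _ _ := halfMat_add _ _ _ _
  map_smul' r _ := (halfMat_smul r _ _).trans (Complex.coe_smul _ _)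

/-- The axial field `X`, as a function of the two chiral parts of a free one-form. -/
noncomputable def axialLin : Fibre × Fibre →ₗ[ℝ] Matrix Internal Internal ℂ :=
  (1 / 2 : ℂ) • (halfLin - halfLin ∘ₗ (LinearEquiv.prodComm ℝ Fibre Fibre).toLinearMap)

/-- The vector field `Y`, as a function of the two chiral parts of a free one-form. -/
noncomputable def vectorLin : Fibre × Fibre →ₗ[ℝ] Matrix Internal Internal ℂ :=
  (-Complex.I / 2) • (halfLin + halfLin ∘ₗ (LinearEquiv.prodComm ℝ Fibre Fibre).toLinearMap)

theorem axialLin_apply (u : Fibre × Fibre) :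
    axialLin u = (1 / 2 : ℂ) • (halfMat u.1 u.2 - halfMat u.2 u.1) := rfl

theorem vectorLin_apply (u : Fibre × Fibre) :
    vectorLin u = (-Complex.I / 2) • (halfMat u.1 u.2 + halfMat u.2 u.1) := rfl

/-- The matrix `diag(Z, Z̄)` of `A + J A J⁻¹`, in terms of the two chiral parts of a free
one-form. -/
noncomputable def fluctLin : Fibre × Fibre →ₗ[ℝ] Matrix Full Full ℂ where
  toFun u := blockMat (halfMat u.1 u.2) (halfMat u.2 u.1) (conjMat (halfMat u.1 u.2))
    (conjMat (halfMat u.2 u.1))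
  map_add' u w := by
    simp only [Prod.fst_add, Prod.snd_add, halfMat_add, conjMat_add, blockMat_add]
  map_smul' r u := by
    simp only [Prod.smul_fst, Prod.smul_snd, halfMat_smul, conjMat_smul, Complex.star_def,
      Complex.conj_ofReal, blockMat_smul, RingHom.id_apply]
    exact Complex.coe_smul _ _

theorem fluctLin_apply (u : Fibre × Fibre) : fluctLin u = blockMat (halfMat u.1 u.2)
    (halfMat u.2 u.1) (conjMat (halfMat u.1 u.2)) (conjMat (halfMat u.2 u.1)) := rfl

theorem gamma5_kronecker_add (X Y : Matrix Internal Internal ℂ) :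
    gamma5 ⊗ₖ X + (1 : Matrix SpinIx SpinIx ℂ) ⊗ₖ Y = chiral (Y + X) (Y - X) := by
  ext ⟨s, p⟩ ⟨t, q⟩
  rcases s with s | s <;> rcases t with t | t <;>
    simp [gamma5, chiral, Matrix.kroneckerMap_apply, Matrix.one_apply, mul_add, mul_sub] <;> ring

/-- The fluctuation in terms of `X` and `Y`: the right- and left-handed blocks of `A + J A J⁻¹` are
`i Y ± X`. -/
theorem fluctLin_eq_fromBlocks (u : Fibre × Fibre) :
    fluctLin u = Matrix.fromBlocks
      (gamma5 ⊗ₖ axialLin u + (1 : Matrix SpinIx SpinIx ℂ) ⊗ₖ (Complex.I • vectorLin u)) 0 0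
      (conjMat (gamma5 ⊗ₖ axialLin u
        + (1 : Matrix SpinIx SpinIx ℂ) ⊗ₖ (Complex.I • vectorLin u))) := by
  have hI : Complex.I * (-Complex.I / 2) = 1 / 2 := by
    linear_combination (-1 / 2 : ℂ) * Complex.I_mul_I
  have h1 : Complex.I • vectorLin u + axialLin u = halfMat u.1 u.2 := by
    rw [vectorLin_apply, axialLin_apply, smul_smul, hI]
    module
  have h2 : Complex.I • vectorLin u - axialLin u = halfMat u.2 u.1 := by
    rw [vectorLin_apply, axialLin_apply, smul_smul, hI]
    module
  rw [gamma5_kronecker_add, h1, h2, conjMat_chiral, fluctLin_apply, blockMat]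

/-- The real structure commutes with `-i γ^c` and exchanges particles and antiparticles. -/
theorem realStructureMat_mul_conjMat_oneForm {Qr Ql Mr Ml : Fin 4 → Matrix Internal Internal ℂ} :
    realStructureMat * conjMat (-Complex.I • ∑ c, spinLift (gammaE c)
        * blockMat (Qr c) (Ql c) (Mr c) (Ml c))
      = (-Complex.I • ∑ c, spinLift (gammaE c) * blockMat (conjMat (Mr c)) (conjMat (Ml c))
          (conjMat (Qr c)) (conjMat (Ql c))) * realStructureMat := by
  have hI : star (-Complex.I) = Complex.I := by simp
  rw [conjMat_smul, conjMat_sum, hI, Matrix.mul_smul, Finset.mul_sum, Matrix.smul_mul,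
    Finset.sum_mul, neg_smul, ← smul_neg, ← Finset.sum_neg_distrib]
  congr 1
  refine Finset.sum_congr rfl fun c _ => ?_
  rw [conjMat_mul, ← mul_assoc, realStructureMat_mul_spinLift, conjMat_blockMat, neg_mul,
    mul_assoc, realStructureMat_mul_blockMat, mul_assoc]

variable {M : Type*} [TopologicalSpace M] [ChartedSpace E4 M] {n : ℕ}
  {ι : Type*}

theorem mdifferentiableAt_opJinv {ψ : LocalSpinor M ι} {i : ι} {x : M}
    (hψ : ∀ p, MDifferentiableAt (𝓡 4) 𝓘(ℝ, ℂ) (fun y => ψ i y p) x) (p : Full) :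
    MDifferentiableAt (𝓡 4) 𝓘(ℝ, ℂ) (fun y => opJinv ψ i y p) x := by
  let L : (Full → ℂ) →ₗ[ℝ] ℂ :=
    { toFun := fun v => (-(realStructureMat *ᵥ star v)) p
      map_add' := fun v w => by
        rw [star_add, Matrix.mulVec_add, neg_add, Pi.add_apply]
      map_smul' := fun r v => by
        have h : star (r • v) = (r : ℂ) • star v := by
          ext q
          simp
        rw [h, Matrix.mulVec_smul, ← smul_neg, Pi.smul_apply]
        simp }
  exact mdifferentiableAt_linear L (mdifferentiableAt_pi hψ)

theorem isSmoothOneForm_linear [IsManifold (𝓡 4) ∞ M] (a b : Fin n → TwistedAlgebra M)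
    (L : Fibre × Fibre →ₗ[ℝ] Matrix Internal Internal ℂ) :
    IsSmoothOneForm fun (x : M) v => L (formPair a b x v) := by
  refine ⟨fun x u v => ?_, fun x r v => ?_, fun φ hφ μ p q => ?_⟩
  · exact map_add (L ∘ₗ formPair a b x) u v
  · exact (map_smul (L ∘ₗ formPair a b x) r v).trans (Complex.coe_smul _ _).symm
  · exact contMDiffOn_formFibre_linear (Matrix.entryLinearMap ℝ ℂ p q ∘ₗ L) a b
      (contMDiffOn_coordVec hφ μ)

variable [IsManifold (𝓡 4) ∞ M] [RiemannianBundle (fun x : M => TangentSpace (𝓡 4) x)]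

theorem opJ_freeOneForm_opJinv (S : SpinStructure M ι) (a b : Fin n → TwistedAlgebra M)
    {ψ : LocalSpinor M ι} {i : ι} {x : M}
    (hψ : ∀ p, MDifferentiableAt (𝓡 4) 𝓘(ℝ, ℂ) (fun y => ψ i y p) x)
    {Qr Ql Mr Ml : Fin 4 → Matrix Internal Internal ℂ}
    (h : ∀ c, formComponent a b x (S.frame i c x) = blockMat (Qr c) (Ql c) (Mr c) (Ml c)) :
    opJ (freeOneForm S a b (opJinv ψ)) i x
      = (-Complex.I • ∑ c, spinLift (gammaE c) * blockMat (conjMat (Mr c)) (conjMat (Ml c))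
          (conjMat (Qr c)) (conjMat (Ql c))) *ᵥ ψ i x := by
  have h1 : opJ (freeOneForm S a b (opJinv ψ)) i x
      = realStructureFun (oneFormMat S a b i x *ᵥ realStructure.symm (ψ i x)) := by
    rw [opJ, freeOneForm_apply S a b (opJinv ψ) i x (mdifferentiableAt_opJinv hψ)]
    rfl
  have h2 : oneFormMat S a b i x
      = -Complex.I • ∑ c, spinLift (gammaE c) * blockMat (Qr c) (Ql c) (Mr c) (Ml c) := by
    simp only [oneFormMat, h]
  rw [h1, h2, realStructureFun_mulVec _ _ realStructureMat_mul_conjMat_oneForm]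
  congr 1
  exact realStructure.apply_symm_apply (ψ i x)

theorem fluctuation_apply (S : SpinStructure M ι) (a b : Fin n → TwistedAlgebra M)
    {ψ : LocalSpinor M ι} {i : ι} {x : M}
    (hψ : ∀ p, MDifferentiableAt (𝓡 4) 𝓘(ℝ, ℂ) (fun y => ψ i y p) x) :
    fluctuation S a b ψ i x
      = (-Complex.I • ∑ c, spinLift (gammaE c) * fluctLin (formPair a b x (S.frame i c x)))
        *ᵥ ψ i x := by
  have h (c : Fin 4) := formComponent_eq a b x (S.frame i c x)
  have hJ := opJ_freeOneForm_opJinv S a b hψ h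
  rw [fluctuation, Pi.add_apply, Pi.add_apply, hJ, freeOneForm_apply S a b ψ i x hψ, oneFormMat,
    ← Matrix.add_mulVec, ← smul_add, ← Finset.sum_add_distrib]
  congr 2
  refine Finset.sum_congr rfl fun c _ => ?_
  rw [← mul_add, h, fibreRep, ← blockMat_add, fluctLin_apply]
  simp only [halfMat, conjMat_add, conjMat_conjMat]
  rw [add_comm (antiparticleBlock _ _), add_comm (antiparticleBlock _ _)]
  rfl

/-- The fluctuation in the coordinates of a chart. -/
theorem sum_gammaCurved_mul (S : SpinStructure M ι) {φ : OpenPartialHomeomorph M E4}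
    (hφ : φ ∈ IsManifold.maximalAtlas (𝓡 4) ∞ M) {x : M} (hx : x ∈ φ.source) (i : ι)
    (L : TangentSpace (𝓡 4) x →ₗ[ℝ] Matrix Full Full ℂ) :
    ∑ μ, spinLift (gammaCurved S i φ μ x) * L (coordVec φ μ x)
      = ∑ c, spinLift (gammaE c) * L (S.frame i c x) := by
  have h (c : Fin 4) : L (S.frame i c x)
      = ∑ μ, (coordComp φ μ x (S.frame i c x) : ℂ) • L (coordVec φ μ x) := by
    conv_lhs => rw [← sum_coordComp_smul_coordVec hφ hx (S.frame i c x)]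
    rw [map_sum]
    exact Finset.sum_congr rfl fun μ _ => (map_smul L _ _).trans (Complex.coe_smul _ _).symm
  simp only [h, gammaCurved, spinLift_sum, spinLift_smul, Finset.mul_sum, Finset.sum_mul,
    Matrix.smul_mul, Matrix.mul_smul]
  rw [Finset.sum_comm]

end Fluctuation

/-! ### The axial and vector parts -/

section Parts

theorem fibreStar_fibreStar (u : Fibre) : fibreStar (fibreStar u) = u :=
  Prod.ext (star_star _) (Prod.ext (star_star _) (by funext i j; exact star_star _))

theorem particleBlock_conjTranspose (u u' : Fibre) :
    (particleBlock u u')ᴴ = particleBlock (fibreStar u) (fibreStar u') := by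
  simp [particleBlock, particleRep, Matrix.conjTranspose_kronecker, flavourRep_star, fibreStar]

theorem antiparticleBlock_conjTranspose (u u' : Fibre) :
    (antiparticleBlock u u')ᴴ = antiparticleBlock (fibreStar u) (fibreStar u') := by
  have h (u : Fibre) : Matrix.of (fibreStar u).2.2 = (Matrix.of u.2.2)ᴴ := by
    ext i j
    simp [fibreStar]
  have hd : dottedᴴ = dotted := by simp [dotted, Matrix.fromBlocks_conjTranspose]
  have hu : undottedᴴ = undotted := by simp [undotted, Matrix.fromBlocks_conjTranspose]
  simp only [antiparticleBlock, Matrix.conjTranspose_add, Matrix.conjTranspose_kronecker,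
    colourRep_star, hd, hu, h]
  rfl

theorem conjMat_conjTranspose {m n : Type*} (A : Matrix m n ℂ) :
    (conjMat A)ᴴ = conjMat Aᴴ := by
  ext i j
  simp [conjMat]

theorem halfMat_conjTranspose (u u' : Fibre) :
    (halfMat u u')ᴴ = halfMat (fibreStar u) (fibreStar u') := by
  rw [halfMat, Matrix.conjTranspose_add, conjMat_conjTranspose, particleBlock_conjTranspose,
    antiparticleBlock_conjTranspose, halfMat]

theorem halfMat_conjTranspose_of_eq {u u' : Fibre} (h : u' = -fibreStar u) :
    (halfMat u u')ᴴ = -halfMat u' u ∧ (halfMat u' u)ᴴ = -halfMat u u' := by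
  have h1 : fibreStar u = -u' := by rw [h, neg_neg]
  have hneg (w : Fibre) : fibreStar (-w) = -fibreStar w := by
    have h := fibreStar_smul (-1) w
    rwa [neg_one_smul, neg_one_smul] at h
  have h2 : fibreStar u' = -u := by rw [h, hneg, fibreStar_fibreStar]
  rw [halfMat_conjTranspose, halfMat_conjTranspose, h1, h2]
  exact ⟨map_neg halfLin (u', u), map_neg halfLin (u, u')⟩

/-- The field `X` is selfadjoint, as the adjoint of the right-handed block is minus the left-handed
one. -/
theorem isHermitian_axialLin {u u' : Fibre} (h : u' = -fibreStar u) :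
    (axialLin (u, u')).IsHermitian := by
  obtain ⟨h1, h2⟩ := halfMat_conjTranspose_of_eq h
  rw [Matrix.IsHermitian, axialLin_apply, Matrix.conjTranspose_smul, Matrix.conjTranspose_sub,
    h1, h2]
  have hs : star (1 / 2 : ℂ) = 1 / 2 := by simp
  rw [hs, sub_neg_eq_add, neg_add_eq_sub]

theorem isHermitian_vectorLin {u u' : Fibre} (h : u' = -fibreStar u) :
    (vectorLin (u, u')).IsHermitian := by
  obtain ⟨h1, h2⟩ := halfMat_conjTranspose_of_eq h
  rw [Matrix.IsHermitian, vectorLin_apply, Matrix.conjTranspose_smul, Matrix.conjTranspose_add,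
    h1, h2]
  have hs : star (-Complex.I / 2 : ℂ) = Complex.I / 2 := by simp
  rw [hs]
  module

theorem dotted_add_undotted : dotted + undotted = 1 := by
  simp [dotted, undotted, Matrix.fromBlocks_add]

theorem dotted_sub_undotted : dotted - undotted = etaFlavour := by
  simp [dotted, undotted, etaFlavour, sub_eq_add_neg, Matrix.fromBlocks_neg,
    Matrix.fromBlocks_add]

theorem conjMat_dotted : conjMat dotted = dotted := by
  simp [dotted, conjMat_fromBlocks, conjMat_one, conjMat_zero]

theorem conjMat_undotted : conjMat undotted = undotted := by
  simp [undotted, conjMat_fromBlocks, conjMat_one, conjMat_zero]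

theorem etaFlavour_mul_conjMat_antiparticleRep (c : ℂ) (m : Matrix (Fin 3) (Fin 3) ℂ) :
    ((1 : Matrix Colour Colour ℂ) ⊗ₖ etaFlavour) * conjMat (antiparticleRep c m)
      = conjMat (colourRep c m) ⊗ₖ etaFlavour := by
  rw [antiparticleRep, conjMat_kronecker, conjMat_one, ← Matrix.mul_kronecker_mul, one_mul,
    mul_one]

/-- When the left-handed fields are opposite to the right-handed ones, the undotted antiparticle
entries change sign, which is the effect of `η`; the same sign turns `-p` into `p`, since a
particle block takes its quaternion from the second argument. -/
theorem halfMat_self_neg (c : ℂ) (p : ℍ[ℝ]) (G : Matrix (Fin 3) (Fin 3) ℂ) {u : Fibre}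
    (hu : u = (c, -p, G)) :
    halfMat u (-u) = particleRep c p
      + ((1 : Matrix Colour Colour ℂ) ⊗ₖ etaFlavour) * conjMat (antiparticleRep c G) := by
  have h1 : colourRep (-c) (-G) = -colourRep c G := by
    simpa using colourRep_smul (-1) c G
  have hQ : particleBlock u (-u) = particleRep c p := by
    rw [particleBlock, hu]
    exact congrArg (particleRep c) (neg_neg p)
  have hM : antiparticleBlock u (-u)
      = colourRep c G ⊗ₖ dotted + colourRep (-c) (-G) ⊗ₖ undotted := by
    rw [hu]
    rfl
  rw [halfMat, hQ, hM, h1, etaFlavour_mul_conjMat_antiparticleRep, conjMat_add, conjMat_kronecker,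
    conjMat_kronecker, conjMat_dotted, conjMat_undotted, ← dotted_sub_undotted]
  congr 1
  ext i j
  simp [Matrix.kroneckerMap_apply, conjMat]
  ring

theorem halfMat_self_self (d : ℂ) (q : ℍ[ℝ]) (N : Matrix (Fin 3) (Fin 3) ℂ) {u : Fibre}
    (hu : u = (d, q, N)) :
    halfMat u u = particleRep d q + conjMat (antiparticleRep d N) := by
  have hM : antiparticleBlock u u = colourRep d N ⊗ₖ dotted + colourRep d N ⊗ₖ undotted := by
    rw [hu]
    rfl
  have hQ : particleBlock u u = particleRep d q := by
    rw [hu]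
    rfl
  rw [halfMat, hQ, hM, ← Matrix.kronecker_add, dotted_add_undotted, antiparticleRep]

/-- If the two chiral parts of a free one-form are written as `t ± s`, then `X` depends on `s` only
and `Y` depends on `t` only. -/
theorem axialLin_add_neg (s t : Fibre) : axialLin (s + t, -s + t) = halfMat s (-s) := by
  have h1 : halfMat (-s) s = -halfMat s (-s) := by
    have h := map_neg halfLin (s, -s)
    rw [Prod.neg_mk, neg_neg] at h
    exact h
  rw [axialLin_apply, halfMat_add, halfMat_add, h1]
  module

theorem vectorLin_add_neg (s t : Fibre) :
    Complex.I • vectorLin (s + t, -s + t) = halfMat t t := by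
  have h1 : halfMat (-s) s = -halfMat s (-s) := by
    have h := map_neg halfLin (s, -s)
    rw [Prod.neg_mk, neg_neg] at h
    exact h
  have hI : Complex.I * (-Complex.I / 2) = 1 / 2 := by
    linear_combination (-1 / 2 : ℂ) * Complex.I_mul_I
  rw [vectorLin_apply, halfMat_add, halfMat_add, h1, smul_smul, hI]
  module

end Parts

/-! ### Decomposition of the fields -/

section Fields

theorem sum_smul_gellMann (c : Fin 8 → ℂ) : ∑ k, c k • gellMann k
    = !![c 2 + (Real.sqrt 3 : ℂ)⁻¹ * c 7, c 0 - Complex.I * c 1, c 3 - Complex.I * c 4;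
        c 0 + Complex.I * c 1, -c 2 + (Real.sqrt 3 : ℂ)⁻¹ * c 7, c 5 - Complex.I * c 6;
        c 3 + Complex.I * c 4, c 5 + Complex.I * c 6, -2 * (Real.sqrt 3 : ℂ)⁻¹ * c 7] := by
  ext i j
  fin_cases i <;> fin_cases j <;>
    simp [gellMann, Fin.sum_univ_eight, Matrix.sum_apply] <;> ring

theorem trace_mul_gellMann (m : Matrix (Fin 3) (Fin 3) ℂ) (k : Fin 8) :
    (m * gellMann k).trace
      = ![m 0 1 + m 1 0, Complex.I * (m 0 1 - m 1 0), m 0 0 - m 1 1, m 0 2 + m 2 0,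
          Complex.I * (m 0 2 - m 2 0), m 1 2 + m 2 1, Complex.I * (m 1 2 - m 2 1),
          (Real.sqrt 3 : ℂ)⁻¹ * (m 0 0 + m 1 1 - 2 * m 2 2)] k := by
  fin_cases k <;>
    simp [gellMann, Matrix.trace, Matrix.mul_apply, Fin.sum_univ_three] <;> ring

/-- The completeness of `𝕀₃` and the Gell-Mann matrices in the Hermitian matrices. -/
theorem eq_selfadjoint_add_gellMann (m : Matrix (Fin 3) (Fin 3) ℂ) :
    m = (1 / 2 : ℂ) • (m + mᴴ) + Complex.I • (((m.trace.im / 3 : ℝ) : ℂ) • 1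
      + ∑ k, (((m * gellMann k).trace.im / 2 : ℝ) : ℂ) • gellMann k) := by
  have h3 : (Real.sqrt 3)⁻¹ * (Real.sqrt 3)⁻¹ = 1 / 3 := by
    rw [← mul_inv, Real.mul_self_sqrt (by norm_num)]
    norm_num
  rw [sum_smul_gellMann]
  simp only [trace_mul_gellMann]
  simp only [Matrix.trace, Fin.sum_univ_three, Matrix.diag]
  rw [← Complex.ofReal_inv]
  generalize (Real.sqrt 3)⁻¹ = s at h3
  have h4 (z : ℝ) : s * (s * z) = z / 3 := by
    rw [← mul_assoc, h3]
    ring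
  ext i j
  fin_cases i <;> fin_cases j <;> apply Complex.ext <;> simp [mul_div_assoc, h4] <;>
    first
    | ring1
    | linear_combination ((m 0 0).im + (m 1 1).im - 2 * (m 2 2).im) * h3

variable {M : Type*} [TopologicalSpace M] [ChartedSpace E4 M] {n : ℕ}
  (a b : Fin n → TwistedAlgebra M) (x : M) (v : TangentSpace (𝓡 4) x)

/-- The decomposition of the complex field into the fields `a` and `B`. -/
theorem cRight_eq {g₁ : ℝ} (hg₁ : g₁ ≠ 0) :
    cRight a b x v = fieldA a b x v + -Complex.I * (g₁ / 2) * fieldB a b g₁ x v := by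
  apply Complex.ext
  · simp [fieldA]
  · simp [fieldB]
    field_simp

/-- The imaginary part of the quaternionic field, in the basis of Pauli matrices. -/
theorem exists_qRight_eq {g₂ : ℝ} (hg₂ : g₂ ≠ 0) :
    ∃ q : ℍ[ℝ], quatMat q = -(Complex.I * (g₂ / 2)) • fieldW a b g₂ x v ∧ star q = -q ∧
      qRight a b x v = (fieldw a b x v : ℍ[ℝ]) + q := by
  have h (t : ℝ) : g₂ / 2 * (2 / g₂ * t) = t := by field_simp
  refine ⟨qRight a b x v - (fieldw a b x v : ℍ[ℝ]), ?_, ?_, by abel⟩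
  · ext i j
    fin_cases i <;> fin_cases j <;> apply Complex.ext <;>
      simp [quatMat, fieldW, fieldWcomp, fieldw, pauli, Fin.sum_univ_three] <;>
      field_simp
  · ext <;> simp [fieldw]

/-- The trace condition identifies the coefficient of `i 𝕀₃` in the antiselfadjoint part of the
`M₃(ℂ)`-field with `(g₁ / 6) B`, which fixes `V⁰`. -/
theorem mRight_eq {g₁ g₃ : ℝ} (hg₁ : g₁ ≠ 0) (hg₃ : g₃ ≠ 0)
    (h : (mRight a b x v).trace.im = -(cRight a b x v).im) :
    mRight a b x v = fieldg a b x v + Complex.I • ((g₁ / 6 * fieldB a b g₁ x v : ℂ) • 1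
      + (g₃ / 2 : ℂ) • fieldV a b g₃ x v) := by
  have h1 : (((mRight a b x v).trace.im / 3 : ℝ) : ℂ) = g₁ / 6 * fieldB a b g₁ x v := by
    rw [h, fieldB]
    have : (g₁ : ℂ) ≠ 0 := by exact_mod_cast hg₁
    push_cast
    field_simp
    ring
  have h2 : ∑ k, (((mRight a b x v * gellMann k).trace.im / 2 : ℝ) : ℂ) • gellMann k
      = (g₃ / 2 : ℂ) • fieldV a b g₃ x v := by
    rw [fieldV, Finset.smul_sum]
    refine Finset.sum_congr rfl fun k _ => ?_
    rw [smul_smul, fieldVcomp]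
    congr 1
    have : (g₃ : ℂ) ≠ 0 := by exact_mod_cast hg₃
    push_cast
    field_simp
  rw [← h1, ← h2]
  exact eq_selfadjoint_add_gellMann _

end Fields

/-! ### Components -/

section Components

theorem flavourBlock_add (S T : Matrix Internal Internal ℂ) (α β : Flavour) :
    flavourBlock (S + T) α β = flavourBlock S α β + flavourBlock T α β := rfl

theorem flavourBlock_smul (r : ℂ) (T : Matrix Internal Internal ℂ) (α β : Flavour) :
    flavourBlock (r • T) α β = r • flavourBlock T α β := rfl

theorem flavourBlock_kronecker (A : Matrix Colour Colour ℂ) (B : Matrix Flavour Flavour ℂ)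
    (α β : Flavour) : flavourBlock (A ⊗ₖ B) α β = B α β • A := by
  ext I J
  simp [flavourBlock, Matrix.kroneckerMap_apply, mul_comm]

theorem colourRep_one : colourRep 1 1 = 1 := by
  simp [colourRep]

theorem colourRep_zero : colourRep 0 0 = 0 := by
  simp [colourRep]

theorem conjMat_colourRep (c : ℂ) (m : Matrix (Fin 3) (Fin 3) ℂ) :
    conjMat (colourRep c m) = colourRep (star c) (conjMat m) := by
  simp [colourRep, conjMat_fromBlocks, conjMat_zero, conjMat_smul, conjMat_one]

theorem flavourBlock_axial (c : ℂ) (p : ℍ[ℝ]) (G : Matrix (Fin 3) (Fin 3) ℂ) (α β : Flavour) :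
    flavourBlock (particleRep c p
      + ((1 : Matrix Colour Colour ℂ) ⊗ₖ etaFlavour) * conjMat (antiparticleRep c G)) α β
      = colourRep (flavourRep c p α β + etaFlavour α β * star c)
          (flavourRep c p α β • 1 + etaFlavour α β • conjMat G) := by
  rw [etaFlavour_mul_conjMat_antiparticleRep, particleRep, flavourBlock_add,
    flavourBlock_kronecker, flavourBlock_kronecker, colourRep_add, conjMat_colourRep,
    colourRep_smul, ← colourRep_one, ← colourRep_smul, mul_one]

theorem flavourBlock_vector (c : ℂ) (q : ℍ[ℝ]) (N : Matrix (Fin 3) (Fin 3) ℂ) (α β : Flavour) :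
    flavourBlock (particleRep c q + conjMat (antiparticleRep c N)) α β
      = colourRep (flavourRep c q α β + (1 : Matrix Flavour Flavour ℂ) α β * star c)
          (flavourRep c q α β • 1 + (1 : Matrix Flavour Flavour ℂ) α β • conjMat N) := by
  rw [antiparticleRep, conjMat_kronecker, conjMat_one, particleRep, flavourBlock_add,
    flavourBlock_kronecker, flavourBlock_kronecker, colourRep_add, conjMat_colourRep,
    colourRep_smul, ← colourRep_one, ← colourRep_smul, mul_one]

/-- Recovers `Y` from `i Y`. -/
theorem flavourBlock_eq_of_I_smul {T T' : Matrix Internal Internal ℂ} (h : Complex.I • T = T')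
    (α β : Flavour) : flavourBlock T α β = -Complex.I • flavourBlock T' α β := by
  rw [← h, flavourBlock_smul, smul_smul]
  simp

theorem conjMat_vectorColour (g₁ g₃ B : ℝ) (V : Matrix (Fin 3) (Fin 3) ℂ) :
    conjMat (Complex.I • ((g₁ / 6 * B : ℂ) • 1 + (g₃ / 2 : ℂ) • V))
      = -Complex.I • ((g₁ / 6 * B : ℂ) • 1 + (g₃ / 2 : ℂ) • conjMat V) := by
  simp only [conjMat_smul, conjMat_add, conjMat_one]
  simp

/-- The flavour blocks of `X`. -/
theorem axial_components {X : Matrix Internal Internal ℂ} {A w : ℝ}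
    {G : Matrix (Fin 3) (Fin 3) ℂ}
    (hX : X = particleRep A (w : ℍ[ℝ])
      + ((1 : Matrix Colour Colour ℂ) ⊗ₖ etaFlavour) * conjMat (antiparticleRep A G)) :
    (∀ α β : Fin 2, α ≠ β → flavourBlock X (.inl α) (.inl β) = 0) ∧
    (∀ α β : Fin 2, flavourBlock X (.inl α) (.inr β) = 0 ∧
      flavourBlock X (.inr α) (.inl β) = 0) ∧
    (∀ α : Fin 2, flavourBlock X (.inl α) (.inl α)
      = colourRep (2 * A) ((A : ℂ) • 1 + conjMat G)) ∧
    (∀ α β : Fin 2, flavourBlock X (.inr α) (.inr β)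
      = if α = β then colourRep (w - A) ((w : ℂ) • 1 - conjMat G) else 0) := by
  subst hX
  have hw (α β : Fin 2) : quatMat (w : ℍ[ℝ]) α β = if α = β then (w : ℂ) else 0 := by
    fin_cases α <;> fin_cases β <;> apply Complex.ext <;> simp [quatMat]
  refine ⟨fun α β h => ?_, fun α β => ⟨?_, ?_⟩, fun α => ?_, fun α β => ?_⟩
  · rw [flavourBlock_axial, ← colourRep_zero]
    fin_cases α <;> fin_cases β <;> simp_all [flavourRep, etaFlavour]
  · rw [flavourBlock_axial, ← colourRep_zero]
    simp [flavourRep, etaFlavour]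
  · rw [flavourBlock_axial, ← colourRep_zero]
    simp [flavourRep, etaFlavour]
  · rw [flavourBlock_axial]
    fin_cases α <;> simp [flavourRep, etaFlavour, two_mul]
  · rw [flavourBlock_axial, ← colourRep_zero]
    by_cases h : α = β
    · simp [flavourRep, etaFlavour, hw, h, sub_eq_add_neg]
    · simp [flavourRep, etaFlavour, hw, h]

/-- The flavour blocks of `Y`. -/
theorem vector_components {Y : Matrix Internal Internal ℂ} {g₁ g₂ g₃ B : ℝ}
    {W : Matrix (Fin 2) (Fin 2) ℂ} {V : Matrix (Fin 3) (Fin 3) ℂ} {q : ℍ[ℝ]}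
    (hq : quatMat q = -(Complex.I * (g₂ / 2)) • W)
    (hY : Complex.I • Y = particleRep (-Complex.I * (g₁ / 2) * B) q
      + conjMat (antiparticleRep (-Complex.I * (g₁ / 2) * B)
          (Complex.I • ((g₁ / 6 * B : ℂ) • 1 + (g₃ / 2 : ℂ) • V)))) :
    (∀ α β : Fin 2, α ≠ β → flavourBlock Y (.inl α) (.inl β) = 0) ∧
    (∀ α β : Fin 2, flavourBlock Y (.inl α) (.inr β) = 0 ∧
      flavourBlock Y (.inr α) (.inl β) = 0) ∧
    flavourBlock Y (.inl 0) (.inl 0)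
      = colourRep 0 (-(2 * g₁ / 3 * B : ℂ) • 1 - (g₃ / 2 : ℂ) • conjMat V) ∧
    flavourBlock Y (.inl 1) (.inl 1)
      = colourRep (g₁ * B) ((g₁ / 3 * B : ℂ) • 1 - (g₃ / 2 : ℂ) • conjMat V) ∧
    (∀ α β : Fin 2, flavourBlock Y (.inr α) (.inr β)
      = colourRep ((if α = β then (g₁ / 2 * B : ℂ) else 0) - g₂ / 2 * W α β)
          (-(if α = β then (g₁ / 6 * B : ℂ) • 1 + (g₃ / 2 : ℂ) • conjMat V else 0)
            - (g₂ / 2 * W α β) • 1)) := by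
  have hI (z : ℂ) : Complex.I * (Complex.I * z) = -z := by
    rw [← mul_assoc, Complex.I_mul_I, neg_one_mul]
  have h (α β : Flavour) := flavourBlock_eq_of_I_smul hY α β
  simp only [flavourBlock_vector, conjMat_vectorColour, ← colourRep_smul] at h
  refine ⟨fun α β hne => ?_, fun α β => ⟨?_, ?_⟩, ?_, ?_, fun α β => ?_⟩
  · rw [h, ← colourRep_zero]
    fin_cases α <;> fin_cases β <;> simp_all [flavourRep]
  · rw [h, ← colourRep_zero]
    simp [flavourRep]
  · rw [h, ← colourRep_zero]
    simp [flavourRep]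
  · rw [h]
    congr 1
    · simp [flavourRep]
    · simp only [flavourRep, Matrix.fromBlocks_apply₁₁, Matrix.one_apply_eq]
      ext i j
      simp [mul_add, hI, mul_assoc]
      ring
  · rw [h]
    congr 1
    · simp [flavourRep]
      linear_combination (-(g₁ * B : ℂ)) * Complex.I_mul_I
    · simp only [flavourRep, Matrix.fromBlocks_apply₁₁, Matrix.one_apply_eq]
      ext i j
      simp [mul_add, hI, mul_assoc]
      ring
  · rw [h]
    by_cases hαβ : α = β
    · subst hαβ
      congr 1
      · simp [flavourRep, hq, mul_add, hI, mul_assoc]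
        ring
      · ext i j
        simp [flavourRep, hq, mul_add, hI, mul_assoc]
        ring
    · congr 1
      · simp [flavourRep, hq, hI, mul_assoc, hαβ]
      · ext i j
        simp [flavourRep, hq, hI, mul_assoc, hαβ]

/-- The restrictions of `i Y` to leptons and to quarks. -/
theorem vector_eq_gauge {Y : Matrix Internal Internal ℂ} {g₁ g₂ g₃ B : ℝ}
    {W : Matrix (Fin 2) (Fin 2) ℂ} {V : Matrix (Fin 3) (Fin 3) ℂ} {q : ℍ[ℝ]}
    (hq : quatMat q = -(Complex.I * (g₂ / 2)) • W)
    (hY : Complex.I • Y = particleRep (-Complex.I * (g₁ / 2) * B) q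
      + conjMat (antiparticleRep (-Complex.I * (g₁ / 2) * B)
          (Complex.I • ((g₁ / 6 * B : ℂ) • 1 + (g₃ / 2 : ℂ) • V)))) :
    (Matrix.of fun α β => Complex.I * Y (.inl (), α) (.inl (), β)) = leptonGauge g₁ g₂ B W ∧
    (Matrix.of fun (p q : Fin 3 × Flavour) =>
      Complex.I * Y (.inr p.1, p.2) (.inr q.1, q.2)) = quarkGauge g₁ g₂ g₃ B W (conjMat V) := by
  have h (α β : Flavour) (I J : Colour) : Complex.I * Y (I, α) (J, β) = _ :=
    congrFun (congrFun ((congrArg (fun T => flavourBlock T α β) hY).trans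
      (flavourBlock_vector _ _ _ α β)) I) J
  simp only [conjMat_vectorColour] at h
  constructor
  · ext α β
    rw [Matrix.of_apply, h]
    rcases α with α | α <;> rcases β with β | β
    · fin_cases α <;> fin_cases β <;> simp [leptonGauge, colourRep, flavourRep]
      ring
    · simp [leptonGauge, colourRep, flavourRep]
    · simp [leptonGauge, colourRep, flavourRep]
    · by_cases hαβ : α = β
      · subst hαβ
        simp [leptonGauge, colourRep, flavourRep, hq]
        ring
      · simp [leptonGauge, colourRep, flavourRep, hq, hαβ]
  · ext ⟨i, α⟩ ⟨j, β⟩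
    rw [Matrix.of_apply, h]
    rcases α with α | α <;> rcases β with β | β
    · fin_cases α <;> fin_cases β <;>
        simp [quarkGauge, colourRep, flavourRep, Matrix.kroneckerMap_apply] <;> ring
    · simp [quarkGauge, colourRep, flavourRep, Matrix.kroneckerMap_apply]
    · simp [quarkGauge, colourRep, flavourRep, Matrix.kroneckerMap_apply]
    · by_cases hαβ : α = β
      · subst hαβ
        simp [quarkGauge, colourRep, flavourRep, hq, Matrix.kroneckerMap_apply]
        ring
      · simp [quarkGauge, colourRep, flavourRep, hq, hαβ, Matrix.kroneckerMap_apply]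
        ring

variable {M : Type*} [TopologicalSpace M] [ChartedSpace E4 M] {n : ℕ}

/-- The splitting of a selfadjoint free one-form into its axial and vector parts, in terms of the
physical fields. -/
theorem formPair_eq {a b : Fin n → TwistedAlgebra M} {x : M} {v : TangentSpace (𝓡 4) x}
    (hself : formFibre (rho ∘ a) (rho ∘ b) x v = -fibreStar (formFibre a b x v))
    {A w : ℝ} {c : ℂ} {q : ℍ[ℝ]} {N : Matrix (Fin 3) (Fin 3) ℂ}
    {G : Matrix (Fin 3) (Fin 3) ℂ} (hG : G = fieldg a b x v)
    (hc : cRight a b x v = A + c) (hcstar : star c = -c)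
    (hq : qRight a b x v = (w : ℍ[ℝ]) + q) (hqstar : star q = -q)
    (hm : mRight a b x v = fieldg a b x v + N) {s t : Fibre}
    (hs : s = ((A : ℂ), -(w : ℍ[ℝ]), G)) (ht : t = (c, q, N)) :
    formPair a b x v = (s + t, -s + t) := by
  rw [← hG] at hm
  have hGstar : Gᴴ = G := by
    rw [hG, fieldg, Matrix.conjTranspose_smul, Matrix.conjTranspose_add,
      Matrix.conjTranspose_conjTranspose, add_comm (mRight a b x v)ᴴ]
    simp
  have hNstar : Nᴴ = -N := by
    have hN : N = mRight a b x v - G := by rw [hm]; abel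
    rw [hN, Matrix.conjTranspose_sub, hGstar, hG, fieldg]
    module
  -- `formFibre a b` holds the quaternion of the left-handed particles, opposite to the adjoint of
  -- `qRight a b`
  have hqL : (formFibre a b x v).2.1 = -star (qRight a b x v) := by
    have h : qRight a b x v = -star (formFibre a b x v).2.1 := congrArg (fun u => u.2.1) hself
    rw [h, star_neg, star_star, neg_neg]
  have hr : formFibre a b x v = s + t := by
    rw [hs, ht]
    refine Prod.ext hc (Prod.ext ?_ hm)
    rw [hqL, hq, star_add, hqstar, neg_add, neg_neg, Quaternion.star_coe]
    rfl
  have hstar : -fibreStar (s + t) = -s + t := by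
    rw [hs, ht]
    refine Prod.ext ?_ (Prod.ext ?_ ?_)
    · change -star ((A : ℂ) + c) = -(A : ℂ) + c
      rw [star_add, hcstar, neg_add, neg_neg, Complex.star_def, Complex.conj_ofReal]
    · change -star (-(w : ℍ[ℝ]) + q) = - -(w : ℍ[ℝ]) + q
      rw [star_add, hqstar, neg_add, neg_neg, star_neg, Quaternion.star_coe]
    · change -(G + N)ᴴ = -G + N
      rw [Matrix.conjTranspose_add, hGstar, hNstar, neg_add, neg_neg]
  refine Prod.ext hr ?_
  exact hself.trans (by rw [hr, hstar])

end Components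

end TwistedSM

theorem mainTheorem4 {M : Type*} [TopologicalSpace M] [T2Space M] [CompactSpace M]
    [ChartedSpace E4 M] [IsManifold (𝓡 4) ∞ M]
    [RiemannianBundle (fun x : M => TangentSpace (𝓡 4) x)]
    [IsContMDiffRiemannianBundle (𝓡 4) ∞ E4 (fun x : M => TangentSpace (𝓡 4) x)]
    {ι : Type*} (S : SpinStructure M ι)
    (g₁ g₂ g₃ : ℝ) (hg₁ : g₁ ≠ 0) (hg₂ : g₂ ≠ 0) (hg₃ : g₃ ≠ 0)
    {n : ℕ} (a b : Fin n → TwistedAlgebra M)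
    (hself : IsSelfadjointOp S (freeOneForm S a b)) (hunim : IsUnimodular a b) :
    ∃ X Y : (x : M) → TangentSpace (𝓡 4) x → Matrix Internal Internal ℂ,
      -- `X` and `Y` are selfadjoint smooth one-forms
      IsSmoothOneForm X ∧ IsSmoothOneForm Y ∧
      (∀ x v, (X x v).IsHermitian) ∧ (∀ x v, (Y x v).IsHermitian) ∧
      -- the twisted fluctuation is `D + Z`, with `Z = -i γ^μ diag(Z_μ, conj Z_μ)`
      (∀ φ ∈ IsManifold.maximalAtlas (𝓡 4) ∞ M, ∀ i, ∀ x ∈ S.patch i ∩ φ.source,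
        ∀ Zmat : Fin 4 → Matrix Half Half ℂ,
        (∀ μ, Zmat μ = gamma5 ⊗ₖ X x (coordVec φ μ x)
          + (1 : Matrix SpinIx SpinIx ℂ) ⊗ₖ (Complex.I • Y x (coordVec φ μ x))) →
        ∀ Z : Matrix Full Full ℂ,
        Z = -Complex.I • ∑ μ, spinLift (gammaCurved S i φ μ x)
          * Matrix.fromBlocks (Zmat μ) 0 0 (conjMat (Zmat μ)) →
        ∀ ψ, IsSmoothSpinor S ψ →
          fluctuation S a b ψ i x = Z *ᵥ ψ i x ∧
          fluctuatedDirac S a b ψ i x = dirac S ψ i x + Z *ᵥ ψ i x) ∧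
      -- the components of `X` and `Y`
      (∀ (x : M) (v : TangentSpace (𝓡 4) x) (A B w : ℝ) (W : Matrix (Fin 2) (Fin 2) ℂ)
        (G V : Matrix (Fin 3) (Fin 3) ℂ),
        A = fieldA a b x v → B = fieldB a b g₁ x v → w = fieldw a b x v →
        W = fieldW a b g₂ x v → G = fieldg a b x v → V = fieldV a b g₃ x v →
        (∀ α β : Fin 2, α ≠ β →
          flavourBlock (X x v) (.inl α) (.inl β) = 0 ∧
          flavourBlock (Y x v) (.inl α) (.inl β) = 0) ∧
        (∀ α β : Fin 2,
          flavourBlock (X x v) (.inl α) (.inr β) = 0 ∧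
          flavourBlock (X x v) (.inr α) (.inl β) = 0 ∧
          flavourBlock (Y x v) (.inl α) (.inr β) = 0 ∧
          flavourBlock (Y x v) (.inr α) (.inl β) = 0) ∧
        (∀ α : Fin 2, flavourBlock (X x v) (.inl α) (.inl α)
          = colourRep (2 * A) ((A : ℂ) • 1 + conjMat G)) ∧
        flavourBlock (Y x v) (.inl 0) (.inl 0)
          = colourRep 0 (-(2 * g₁ / 3 * B : ℂ) • 1 - (g₃ / 2 : ℂ) • conjMat V) ∧
        flavourBlock (Y x v) (.inl 1) (.inl 1)
          = colourRep (g₁ * B) ((g₁ / 3 * B : ℂ) • 1 - (g₃ / 2 : ℂ) • conjMat V) ∧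
        (∀ α β : Fin 2, flavourBlock (X x v) (.inr α) (.inr β)
          = if α = β then colourRep (w - A) ((w : ℂ) • 1 - conjMat G) else 0) ∧
        (∀ α β : Fin 2, flavourBlock (Y x v) (.inr α) (.inr β)
          = colourRep ((if α = β then (g₁ / 2 * B : ℂ) else 0) - g₂ / 2 * W α β)
              (-(if α = β then (g₁ / 6 * B : ℂ) • 1 + (g₃ / 2 : ℂ) • conjMat V else 0)
                - (g₂ / 2 * W α β) • 1)) ∧
        -- `X` and `Y` come from one-forms with values in `ℂ ⊕ ℍ ⊕ M₃(ℂ)`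
        X x v = particleRep A (w : ℍ[ℝ])
          + ((1 : Matrix Colour Colour ℂ) ⊗ₖ etaFlavour) * conjMat (antiparticleRep A G) ∧
        (∃ q : ℍ[ℝ], quatMat q = -(Complex.I * (g₂ / 2)) • W ∧
          Complex.I • Y x v = particleRep (-Complex.I * (g₁ / 2) * B) q
            + conjMat (antiparticleRep (-Complex.I * (g₁ / 2) * B)
                (Complex.I • ((g₁ / 6 * B : ℂ) • 1 + (g₃ / 2 : ℂ) • V)))) ∧
        -- `i Y` is the gauge field of the Standard Model, on leptons and on quarks
        (Matrix.of fun α β => Complex.I * Y x v (.inl (), α) (.inl (), β))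
          = leptonGauge g₁ g₂ B W ∧
        (Matrix.of fun (p q : Fin 3 × Flavour) =>
            Complex.I * Y x v (.inr p.1, p.2) (.inr q.1, q.2))
          = quarkGauge g₁ g₂ g₃ B W (conjMat V)) := by
  have hstar (x : M) (v : TangentSpace (𝓡 4) x) :
      formFibre (rho ∘ a) (rho ∘ b) x v = -fibreStar (formFibre a b x v) :=
    formFibre_rho_eq_neg_fibreStar (fun _ _ hx => isHermitian_oneFormMat hself hx) x v
  have htr (x : M) (v : TangentSpace (𝓡 4) x) :
      (mRight a b x v).trace.im = -(cRight a b x v).im := by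
    have h := hunim x v
    rw [formComponent_eq, hstar] at h
    exact im_trace_of_trace_fibreRep h
  refine ⟨fun x v => axialLin (formPair a b x v), fun x v => vectorLin (formPair a b x v),
    isSmoothOneForm_linear a b axialLin, isSmoothOneForm_linear a b vectorLin,
    fun x v => isHermitian_axialLin (hstar x v), fun x v => isHermitian_vectorLin (hstar x v),
    ?_, ?_⟩
  · intro φ hφ i x hx Zmat hZmat Z hZ ψ hψ
    have hfluct : fluctuation S a b ψ i x = Z *ᵥ ψ i x := by
      rw [fluctuation_apply S a b (fun p => hψ.mdifferentiableAt hx.1 p), hZ]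
      congr 2
      refine (sum_gammaCurved_mul S hφ hx.2 i (fluctLin ∘ₗ formPair a b x)).symm.trans ?_
      refine Finset.sum_congr rfl fun μ _ => ?_
      rw [hZmat, LinearMap.comp_apply, fluctLin_eq_fromBlocks]
    refine ⟨hfluct, ?_⟩
    rw [← hfluct]
    rfl
  · intro x v A B w W G V hA hB hw hW hG hV
    obtain ⟨q, hq, hqstar, hqR⟩ := exists_qRight_eq a b x v hg₂
    have hc := cRight_eq a b x v hg₁
    have hm := mRight_eq a b x v hg₁ hg₃ (htr x v)
    rw [← hA, ← hB] at hc
    rw [← hB, ← hV] at hm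
    rw [← hW] at hq
    rw [← hw] at hqR
    have hcstar : star (-Complex.I * (g₁ / 2) * B : ℂ) = -(-Complex.I * (g₁ / 2) * B) := by
      simp
    have hpair := formPair_eq (hstar x v) hG hc hcstar hqR hqstar hm rfl rfl
    have hX := (congrArg axialLin hpair).trans
      ((axialLin_add_neg _ _).trans (halfMat_self_neg A w G rfl))
    have hY := (congrArg (fun u => Complex.I • vectorLin u) hpair).trans
      ((vectorLin_add_neg _ _).trans (halfMat_self_self _ q _ rfl))
    obtain ⟨hX1, hX2, hX3, hX4⟩ := axial_components hX
    obtain ⟨hY1, hY2, hY3, hY4, hY5⟩ := vector_components hq hY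
    obtain ⟨hl, hk⟩ := vector_eq_gauge hq hY
    exact ⟨fun α β h => ⟨hX1 α β h, hY1 α β h⟩,
      fun α β => ⟨(hX2 α β).1, (hX2 α β).2, (hY2 α β).1, (hY2 α β).2⟩,
      hX3, hY3, hY4, hX4, hY5, hX, ⟨q, hq, hY⟩, hl, hk⟩
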